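/- Let $\mathcal H_1,\mathcal H_2$ be separable complex Hilbert spaces. Products of (unbounded) linear operators are maximally defined, i.e. $\operatorname{dom}(AB)=\{f\in\operatorname{dom}(B)\mid Bf\in\operatorname{dom}(A)\}$. For $p\in[1,\infty)$, $\mathcal B_p$ denotes the Schatten class of compact operators whose singular values (counted with multiplicity) lie in $\ell^p$, with norm the $\ell^p$-norm of the singular values. For $\omega\in(0,\pi)$ put $S_\omega=\{z\in\mathbb C\mid z\neq0,\ |\arg z|<\omega\}$, and put $S_0=(0,\infty)$. A densely defined closed operator $T$ in a Hilbert space $\mathcal H$ is called *sectorial* if, for some $\omega\in[0,\pi)$, $\sigma(T)\subseteq\overline{S_\omega}$ and $\sup_{z\in\mathbb C\setminus\overline{S_{\omega'}}}\|z(T-zI)^{-1}\|<\infty$ for all $\omega'\in(\omega,\pi)$. If $T$ is sectorial and $T^{-1}\in\mathcal B(\mathcal H)$, then for $\operatorname{Re}z>0$ one defines $$T^{-z}=\frac1{2\pi i}\int_\Gamma \zeta^{-z}(T-\zeta I)^{-1}\,d\zeta\in\mathcal B(\mathcal H)$$ with the principal branch of $\zeta^{-z}$, where $\Gamma\subset(\mathbb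 C\setminus(-\infty,0])\cap\rho(T)$ runs from $\infty e^{-i\varphi}$ to $\delta e^{-i\varphi}$ along a ray, to $\delta e^{i\varphi}$ along the arc $\{\delta e^{it}\mid |t|\le\varphi\}$, and to $\infty e^{i\varphi}$ along a ray; here $\varphi\in(\omega,\pi)$, and $\delta>0$ is such that $\{|\zeta|\le\delta\}\subset\rho(T)$. For $s\in\mathbb R$, $T^{is}f=\lim_{w\to-is,\ \operatorname{Re}w>0}T^{-w}f$, with domain the set of all $f\in\mathcal H$ for which this limit exists. For $N\ge1$ and $\theta\ge0$ one writes $T\in\mathrm{BIP}(N,\theta)$ if, for all $s\in\mathbb R$, $T^{is}\in\mathcal B(\mathcal H)$ and $\|T^{is}\|\le Ne^{\theta|s|}$. **Corollary 4.8.** Let $T_j$ be sectorial operators in $\mathcal H_j$ with $T_j^{-1}\in\mathcal B(\mathcal H_j)$ and $T_j\in\mathrm{BIP}(N_j,\theta_j)$, where $N_j\ge1$ and $\theta_j\ge0$, $j=1,2$. Let $S$ be a closed operator from $\operatorname{dom}(S)\subseteq\mathcal H_1$ into $\mathcal H_2$ with $\operatorname{dom}(S)\supseteq\operatorname{dom}(T_1)$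 and $\operatorname{dom}(S^*)\supseteq\operatorname{dom}(T_2^*)$. Let $p\in[1,\infty)$ and assume that $$ST_1^{-1}\in\mathcal B_p(\mathcal H_1,\mathcal H_2),\qquad S^*(T_2^*)^{-1}\in\mathcal B_p(\mathcal H_2,\mathcal H_1).$$ Then for every $z\in\mathbb C$ with $0\le\operatorname{Re}z\le1$ the operator $T_2^{-z}ST_1^{-1+z}$ is well defined on $\operatorname{dom}(T_1)$, it is closable as an operator with that domain, and its closure satisfies $\overline{T_2^{-z}ST_1^{-1+z}}\in\mathcal B_p(\mathcal H_1,\mathcal H_2)$. Moreover, for every $k\in(0,\infty)$ and every such $z$, $$\big\|\overline{T_2^{-z}ST_1^{-1+z}}\big\|_{\mathcal B_p(\mathcal H_1,\mathcal H_2)}\le N_1N_2\,e^{k(\operatorname{Im}z)^2+k\operatorname{Re}(z)[1-\operatorname{Re}(z)]+(4k)^{-1}(\theta_1+\theta_2)^2}\,\big\|ST_1^{-1}\big\|_{\mathcal B_p(\mathcal H_1,\mathcal H_2)}^{1-\operatorname{Re}z}\,\big\|S^*(T_2^*)^{-1}\big\|_{\mathcal B_p(\mathcal H_2,\mathcal H_1)}^{\operatorname{Re}z},$$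 and for every $x\in[0,1]$, $$\big\|\overline{T_2^{-x}ST_1^{-1+x}}\big\|_{\mathcal B_p(\mathcal H_1,\mathcal H_2)}\le N_1N_2\,e^{(\theta_1+\theta_2)[x(1-x)]^{1/2}}\,\big\|ST_1^{-1}\big\|_{\mathcal B_p(\mathcal H_1,\mathcal H_2)}^{1-x}\,\big\|S^*(T_2^*)^{-1}\big\|_{\mathcal B_p(\mathcal H_2,\mathcal H_1)}^{x}$$ (with the convention $0^0=1$). -/

import Mathlib

open MeasureTheory Filter Topology
open scoped LinearPMap

noncomputable section

namespace SectorialInterpolation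

variable {E F G H : Type*}
  [NormedAddCommGroup E] [InnerProductSpace ℂ E]
  [NormedAddCommGroup F] [InnerProductSpace ℂ F]
  [NormedAddCommGroup G] [InnerProductSpace ℂ G]
  [NormedAddCommGroup H] [InnerProductSpace ℂ H]

/-! ### Unbounded operators: products, bounded operators, resolvents -/

/-- A bounded operator, regarded as an everywhere defined linear operator. -/
def ofBounded (B : E →L[ℂ] F) : E →ₗ.[ℂ] F :=
  (B : E →ₗ[ℂ] F).toPMap ⊤

/-- The maximal domain `{x ∈ dom B | B x ∈ dom A}` of the operator product `A B`. -/
def opProdDomain (A : F →ₗ.[ℂ] G) (B : E →ₗ.[ℂ] F) : Submodule ℂ E :=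
  (A.domain.comap B.toFun).map B.domain.subtype

theorem opProdDomain_le (A : F →ₗ.[ℂ] G) (B : E →ₗ.[ℂ] F) :
    opProdDomain A B ≤ B.domain := by
  rintro x ⟨y, -, rfl⟩
  exact y.2

theorem mem_domain_of_mem_opProdDomain (A : F →ₗ.[ℂ] G) (B : E →ₗ.[ℂ] F)
    (x : opProdDomain A B) :
    B.toFun (Submodule.inclusion (opProdDomain_le A B) x) ∈ A.domain := by
  obtain ⟨x, y, hy, rfl⟩ := x
  exact hy

/-- The operator product `A B`, maximally defined. -/
def opProd (A : F →ₗ.[ℂ] G) (B : E →ₗ.[ℂ] F) : E →ₗ.[ℂ] G where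
  domain := opProdDomain A B
  toFun := A.toFun ∘ₗ
    (B.toFun ∘ₗ Submodule.inclusion (opProdDomain_le A B)).codRestrict A.domain
      (mem_domain_of_mem_opProdDomain A B)

/-- `R` is the bounded, everywhere defined inverse of `T - z I`. -/
def IsResolventAt (T : H →ₗ.[ℂ] H) (z : ℂ) (R : H →L[ℂ] H) : Prop :=
  (∀ x : T.domain, R (T x - z • (x : H)) = x) ∧
    ∀ y : H, ∃ h : R y ∈ T.domain, T ⟨R y, h⟩ - z • R y = y

/-- The resolvent set `ρ(T)`. -/
def resSet (T : H →ₗ.[ℂ] H) : Set ℂ :=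
  {z | ∃ R : H →L[ℂ] H, IsResolventAt T z R}

open Classical in
/-- `(T - z I)⁻¹` for `z ∈ ρ(T)`; it is set to `0` off the resolvent set. -/
def resolvent (T : H →ₗ.[ℂ] H) (z : ℂ) : H →L[ℂ] H :=
  if h : z ∈ resSet T then h.choose else 0

/-! ### Sectorial operators -/

open Classical in
/-- The open sector `S_ω`; for `ω = 0` it is the half-line `(0, ∞)`. -/
def sector (ω : ℝ) : Set ℂ :=
  if ω = 0 then {z | 0 < z.re ∧ z.im = 0} else {z | z ≠ 0 ∧ |z.arg| < ω}

/-- `T ∈ Sect(ω)`. The spectrum is the complement of the resolvent set. -/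
structure IsSectorialOfAngle (T : H →ₗ.[ℂ] H) (ω : ℝ) : Prop where
  dense_domain : Dense (T.domain : Set H)
  isClosed : T.IsClosed
  angle_nonneg : 0 ≤ ω
  angle_lt_pi : ω < Real.pi
  spectrum_subset : (resSet T)ᶜ ⊆ closure (sector ω)
  resolvent_bound : ∀ ω' : ℝ, ω < ω' → ω' < Real.pi →
    ∃ C : ℝ, ∀ z : ℂ, z ∉ closure (sector ω') → ‖z • resolvent T z‖ ≤ C

/-- `T` is sectorial of some angle in `[0, π)`. -/
def IsSectorial (T : H →ₗ.[ℂ] H) : Prop :=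
  ∃ ω : ℝ, IsSectorialOfAngle T ω

/-! ### Complex powers -/

/-- The contour made of the two rays `{r e^{± i φ} | r ≥ δ}` and the arc
`{δ e^{i t} | |t| ≤ φ}` surrounds the spectrum of `T` inside
`(ℂ \ (-∞, 0]) ∩ ρ(T)`. -/
structure IsAdmissibleContour (T : H →ₗ.[ℂ] H) (φ δ : ℝ) : Prop where
  angle : ∃ ω : ℝ, ω < φ ∧ IsSectorialOfAngle T ω
  angle_lt_pi : φ < Real.pi
  radius_pos : 0 < δ
  ball_subset : Metric.closedBall (0 : ℂ) δ ⊆ resSet T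

/-- The Dunford integral `(2πi)⁻¹ ∮ ζ^{-z} (T - ζ I)⁻¹ dζ` over the contour with parameters
`φ, δ`, run through from `∞ e^{-iφ}` to `δ e^{-iφ}`, along the arc to `δ e^{iφ}`, and on to
`∞ e^{iφ}` (clockwise around the spectrum). -/
def dunfordIntegral (T : H →ₗ.[ℂ] H) (φ δ : ℝ) (z : ℂ) : H →L[ℂ] H :=
  let f : ℂ → (H →L[ℂ] H) := fun ζ => ζ ^ (-z) • resolvent T ζ
  let u : ℝ → ℂ := fun t => Complex.exp (t * Complex.I)
  (2 * Real.pi * Complex.I)⁻¹ •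
    (-(∫ r in Set.Ioi δ, u (-φ) • f (r * u (-φ)))
      + (∫ t in (-φ)..φ, (Complex.I * δ * u t) • f (δ * u t))
      + ∫ r in Set.Ioi δ, u φ • f (r * u φ))

open Classical in
/-- `T^{-z} ∈ B(H)` for `Re z > 0`: the Dunford integral over an admissible contour
(its value does not depend on the contour). -/
def dunfordPow (T : H →ₗ.[ℂ] H) (z : ℂ) : H →L[ℂ] H :=
  if h : ∃ c : ℝ × ℝ, IsAdmissibleContour T c.1 c.2 then
    dunfordIntegral T h.choose.1 h.choose.2 z
  else 0

/-- The filter `w → -is, Re w > 0`. -/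
def approach (s : ℝ) : Filter ℂ :=
  𝓝[{w : ℂ | 0 < w.re}] (-(Complex.I * s))

instance approach_neBot (s : ℝ) : (approach s).NeBot := by
  rw [approach, ← mem_closure_iff_nhdsWithin_neBot, Complex.closure_setOfPred_lt_re]
  simp

/-- The domain of `T^{is}`: the vectors `f` for which `T^{-w} f` converges as
`w → -is`, `Re w > 0`. -/
def imagPowDomain (T : H →ₗ.[ℂ] H) (s : ℝ) : Submodule ℂ H where
  carrier := {f | ∃ g : H, Tendsto (fun w => dunfordPow T w f) (approach s) (𝓝 g)}
  zero_mem' := ⟨0, by simp⟩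
  add_mem' := by
    rintro a b ⟨a', ha⟩ ⟨b', hb⟩
    exact ⟨a' + b', by simpa using ha.add hb⟩
  smul_mem' := by
    rintro c a ⟨a', ha⟩
    exact ⟨c • a', by simpa using ha.const_smul c⟩

/-- The imaginary power `T^{is}`, the strong limit of `T^{-w}` as `w → -is`, `Re w > 0`,
on the set of vectors where this limit exists. -/
def imagPow (T : H →ₗ.[ℂ] H) (s : ℝ) : H →ₗ.[ℂ] H where
  domain := imagPowDomain T s
  toFun :=
    { toFun := fun f => f.2.choose
      map_add' := fun a b => by
        refine tendsto_nhds_unique (a + b).2.choose_spec ?_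
        simpa using a.2.choose_spec.add b.2.choose_spec
      map_smul' := fun c a => by
        refine tendsto_nhds_unique (c • a).2.choose_spec ?_
        simpa using a.2.choose_spec.const_smul c }

open Classical in
/-- `T^{-z}` for `Re z ≥ 0`: the Dunford integral if `Re z > 0`, and the imaginary power
`T^{is}` with `is = -z` if `Re z = 0`. -/
def negPow (T : H →ₗ.[ℂ] H) (z : ℂ) : H →ₗ.[ℂ] H :=
  if 0 < z.re then ofBounded (dunfordPow T z) else imagPow T (-z.im)

/-- The maximally defined product `T₂^{-z} S T₁^{-1+z}`, for `0 ≤ Re z ≤ 1`. -/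
def sandwich (T₁ : E →ₗ.[ℂ] E) (T₂ : F →ₗ.[ℂ] F) (S : E →ₗ.[ℂ] F) (z : ℂ) : E →ₗ.[ℂ] F :=
  opProd (negPow T₂ z) (opProd S (negPow T₁ (1 - z)))

/-- The bound in `T ∈ BIP(N, θ)`: every `T^{is}` is a bounded, everywhere defined operator of
norm at most `N e^{θ|s|}`. -/
structure HasBIP (T : H →ₗ.[ℂ] H) (N θ : ℝ) : Prop where
  one_le : 1 ≤ N
  nonneg : 0 ≤ θ
  bounded : ∀ s : ℝ, ∃ B : H →L[ℂ] H,
    imagPow T s = ofBounded B ∧ ‖B‖ ≤ N * Real.exp (θ * |s|)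

/-! ### Schatten classes -/

/-- The multiplicity of `t > 0` as a singular value of `A`, that is, of `t²` as an eigenvalue
of `A* A`. -/
def singularMultiplicity [CompleteSpace E] [CompleteSpace F] (A : E →L[ℂ] F) (t : ℝ) : ℕ :=
  Module.finrank ℂ
    (Module.End.eigenspace
      ((ContinuousLinearMap.adjoint A ∘L A : E →L[ℂ] E) : E →ₗ[ℂ] E) ((t ^ 2 : ℝ) : ℂ))

/-- `A ∈ B_p(E, F)`: `A` is compact and its singular values, counted with multiplicity, are
`p`-summable. -/
def MemSchatten [CompleteSpace E] [CompleteSpace F] (p : ℝ) (A : E →L[ℂ] F) : Prop :=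
  IsCompactOperator A ∧
    Summable fun t : Set.Ioi (0 : ℝ) => (singularMultiplicity A t : ℝ) * (t : ℝ) ^ p

/-- The norm of `B_p(E, F)`: the `ℓ^p`-norm of the singular values. -/
def schattenNorm [CompleteSpace E] [CompleteSpace F] (p : ℝ) (A : E →L[ℂ] F) : ℝ :=
  (∑' t : Set.Ioi (0 : ℝ), (singularMultiplicity A t : ℝ) * (t : ℝ) ^ p) ^ (1 / p)

end SectorialInterpolation

end

open SectorialInterpolation

noncomputable section

namespace SectorialInterpolation

/-! ### Resolvents -/

section Resolvent

variable {H : Type*} [NormedAddCommGroup H] [InnerProductSpace ℂ H]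
  {T : H →ₗ.[ℂ] H} {z w : ℂ} {R Q : H →L[ℂ] H}

/-! Write `Q_j` for the inverse of `T_j`, `A₁` for `S T₁⁻¹` and `A₂` for `S* (T₂*)⁻¹`. Formally the
sandwiched operators form a holomorphic family on the strip. For `Re z = 0` the operator is `A₁`
between imaginary powers; for `Re z = 1` it is `A₂*` between imaginary powers. A Gaussian factor
absorbs the growth `e^{θ|Im z|}`, and the three lines theorem interpolates.

Schatten norms enter only through the sums `∑ ‖⟪y i, B (x i)⟫‖ ^ p` over finite families. For `B` in
the class these are controlled, for arbitrary families, by the norms of the synthesis operators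
(`MemSchatten.sum_norm_inner_rpow_le`); conversely, a bound over orthonormal families gives
membership and the norm (`memSchatten_of_sum_norm_inner_rpow_le`). Arbitrary families are needed
because imaginary powers destroy orthonormality, whereas they enlarge a synthesis norm by at most
their own norm. Only finite vectors of scalar holomorphic functions then have to be interpolated.

The families are first taken in the dense ranges of `Q₁²` and `Q₂*`. This turns the powers into `U₂
(w + 1)` and `U₁ (2 - w)`, whose exponents have real part at least 1 on the closed strip. There the
Dunford integral is holomorphic across the edges and grows at most exponentially, so no boundary
regularity of `T^{-z}` is needed. The only rule for powers in use is `T⁻¹ T^{-z} = T^{-z} T⁻¹ =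
T^{-(z+1)}` (`map_dunfordIntegral`, carried to the imaginary axis by strong limits); neither a
semigroup law nor independence of the contour is required. The two edges are tied together by `Q₂ A₁
= A₂* Q₁` (`inverse_comp_eq_adjoint_comp_inverse`).

`sum_norm_inner_strip_le` is the resulting estimate, `exists_bounded_interpolant` extends it by
density to a bounded operator, and `sandwich_apply_of_mem` identifies that operator on `dom T₁`.
Optimizing over `k` gives the bound for real `x`. -/

theorem IsResolventAt.unique (hR : IsResolventAt T z R) (hQ : IsResolventAt T z Q) : R = Q := by
  ext y
  obtain ⟨m, e⟩ := hR.2 y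
  have := hQ.1 ⟨R y, m⟩
  rw [e] at this
  exact this.symm

theorem isResolventAt_resolvent (h : z ∈ resSet T) : IsResolventAt T z (resolvent T z) := by
  rw [resolvent, dif_pos h]
  exact h.choose_spec

theorem IsResolventAt.resolvent_eq (hR : IsResolventAt T z R) : resolvent T z = R :=
  (isResolventAt_resolvent ⟨R, hR⟩).unique hR

/-- The resolvent identity. -/
theorem IsResolventAt.sub_eq (hR : IsResolventAt T z R) (hQ : IsResolventAt T w Q) :
    R - Q = (z - w) • (R * Q) := by
  ext y
  obtain ⟨m, e⟩ := hQ.2 y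
  have h1 := hR.1 ⟨Q y, m⟩
  have h2 : y = (T ⟨Q y, m⟩ - z • Q y) + (z - w) • Q y := by
    rw [sub_smul]; nth_rw 1 [← e]; abel
  have h3 : R y = Q y + (z - w) • R (Q y) := by
    conv_lhs => rw [h2]
    rw [map_add, map_smul, h1]
  simp [h3]

theorem IsResolventAt.zero_mul (hR : IsResolventAt T z R) (hQ : IsResolventAt T 0 Q) (hz : z ≠ 0) :
    Q * R = z⁻¹ • (R - Q) := by
  have h := hQ.sub_eq hR
  rw [← neg_sub, h, zero_sub, neg_smul, neg_neg, smul_smul, inv_mul_cancel₀ hz, one_smul]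

theorem IsResolventAt.mul_zero (hR : IsResolventAt T z R) (hQ : IsResolventAt T 0 Q) (hz : z ≠ 0) :
    R * Q = z⁻¹ • (R - Q) := by
  have h := hR.sub_eq hQ
  rw [h, sub_zero, smul_smul, inv_mul_cancel₀ hz, one_smul]

theorem eventually_norm_smul_lt_one (w : ℂ) (Q : H →L[ℂ] H) :
    ∀ᶠ z in 𝓝 w, ‖(z - w) • Q‖ < 1 := by
  have : Tendsto (fun z : ℂ => ‖(z - w) • Q‖) (𝓝 w) (𝓝 ‖(w - w) • Q‖) :=
    Continuous.tendsto (by fun_prop) w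
  rw [sub_self, zero_smul, norm_zero] at this
  exact this.eventually_lt_const one_pos

variable [CompleteSpace H]

/-- On `dom T` one has `T - z = (1 - (z - w) Q)(T - w)`, and the first factor is invertible by the
Neumann series. The explicit formula yields both openness of the resolvent set and continuity of the
resolvent. -/
theorem IsResolventAt.isResolventAt_of_norm_lt (hQ : IsResolventAt T w Q)
    (h : ‖(z - w) • Q‖ < 1) :
    IsResolventAt T z (Q * Ring.inverse (1 - (z - w) • Q)) := by
  have hu : IsUnit (1 - (z - w) • Q) := isUnit_one_sub_of_norm_lt_one h
  constructor
  · intro x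
    have h1 : T x - z • (x : H) = (1 - (z - w) • Q) (T x - w • (x : H)) := by
      simp only [sub_apply, one_apply_eq_self,
        smul_apply, hQ.1 x, sub_smul]
      abel
    have h2 := congrArg (fun A : H →L[ℂ] H => A (T x - w • (x : H)))
      (Ring.inverse_mul_cancel _ hu)
    simp only [mul_apply_eq_comp, one_apply_eq_self] at h2
    rw [h1, mul_apply_eq_comp, h2, hQ.1 x]
  · intro y
    have h2 := congrArg (fun A : H →L[ℂ] H => A y) (Ring.mul_inverse_cancel _ hu)
    simp only [mul_apply_eq_comp, one_apply_eq_self] at h2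
    set v := Ring.inverse (1 - (z - w) • Q) y with hv
    obtain ⟨m, e⟩ := hQ.2 v
    refine ⟨by rwa [mul_apply_eq_comp, ← hv], ?_⟩
    simp only [mul_apply_eq_comp, ← hv]
    refine Eq.trans ?_ h2
    simp only [sub_apply, one_apply_eq_self,
        smul_apply, sub_smul]
    rw [sub_eq_iff_eq_add.1 e]
    abel

theorem isOpen_resSet (T : H →ₗ.[ℂ] H) : IsOpen (resSet T) := by
  rw [isOpen_iff_mem_nhds]
  rintro w ⟨Q, hQ⟩
  filter_upwards [eventually_norm_smul_lt_one w Q] with z hz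
  exact ⟨_, hQ.isResolventAt_of_norm_lt hz⟩

theorem continuousOn_resolvent (T : H →ₗ.[ℂ] H) : ContinuousOn (resolvent T) (resSet T) := by
  rintro w ⟨Q, hQ⟩
  apply ContinuousAt.continuousWithinAt
  have h1 : (fun z => Q * Ring.inverse (1 - (z - w) • Q)) =ᶠ[𝓝 w] resolvent T := by
    filter_upwards [eventually_norm_smul_lt_one w Q] with z hz
    exact (hQ.isResolventAt_of_norm_lt hz).resolvent_eq.symm
  refine ContinuousAt.congr ?_ h1
  refine continuousAt_const.mul ?_
  have h2 : ContinuousAt (fun z : ℂ => 1 - (z - w) • Q) w := by fun_prop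
  have h3 : ContinuousAt Ring.inverse (1 - (w - w) • Q) := by
    have := NormedRing.inverse_continuousAt (1 : (H →L[ℂ] H)ˣ)
    simpa using this
  exact ContinuousAt.comp (f := fun z : ℂ => 1 - (z - w) • Q) h3 h2

end Resolvent

/-! ### Power integrals over rays and arcs -/

section PowerIntegrals

variable {X : Type*} [NormedAddCommGroup X] [NormedSpace ℂ X]

theorem ofReal_mul_exp_cpow {r ψ : ℝ} (hr : 0 < r) (hψ : |ψ| < Real.pi) (z : ℂ) :
    ((r : ℂ) * Complex.exp (ψ * Complex.I)) ^ z = (r : ℂ) ^ z * Complex.exp (z * ψ * Complex.I) := by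
  have h1 := abs_lt.1 hψ
  have hr' : (r : ℂ) ≠ 0 := by exact_mod_cast hr.ne'
  rw [Complex.cpow_def_of_ne_zero (mul_ne_zero hr' (Complex.exp_ne_zero _)),
    Complex.log_ofReal_mul hr (Complex.exp_ne_zero _), Complex.log_exp (by simpa using h1.1)
      (by simpa using h1.2.le), Complex.cpow_def_of_ne_zero hr', ← Complex.exp_add,
    Complex.ofReal_log hr.le]
  ring_nf

theorem integrableOn_ray {δ C : ℝ} (hδ : 0 < δ) {g : ℝ → X} (hg : ContinuousOn g (Set.Ioi δ))
    (hC : ∀ r, δ < r → ‖g r‖ ≤ C * r⁻¹) {z : ℂ} (hz : 0 < z.re) :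
    IntegrableOn (fun r : ℝ => (r : ℂ) ^ (-z) • g r) (Set.Ioi δ) := by
  have h1 : IntegrableOn (fun r : ℝ => C * r ^ (-z.re - 1)) (Set.Ioi δ) :=
    (integrableOn_Ioi_rpow_of_lt (by linarith) hδ).const_mul C
  refine Integrable.mono' h1 ?_ ?_
  · refine ContinuousOn.aestronglyMeasurable ?_ measurableSet_Ioi
    refine ContinuousOn.smul (fun t ht => ?_) hg
    exact (Complex.continuousAt_ofReal_cpow_const _ _
      (Or.inr (hδ.trans ht).ne')).continuousWithinAt
  · refine (ae_restrict_iff' measurableSet_Ioi).2 (Eventually.of_forall fun r hr => ?_)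
    have hr0 : 0 < r := hδ.trans hr
    rw [norm_smul, Complex.norm_cpow_eq_rpow_re_of_pos hr0, Complex.neg_re,
      Real.rpow_sub_one hr0.ne']
    calc r ^ (-z.re) * ‖g r‖ ≤ r ^ (-z.re) * (C * r⁻¹) :=
          mul_le_mul_of_nonneg_left (hC r hr) (Real.rpow_nonneg hr0.le _)
      _ = _ := by ring

theorem norm_integral_ray_le {δ C : ℝ} (hδ : 0 < δ) {g : ℝ → X}
    (hC : ∀ r, δ < r → ‖g r‖ ≤ C * r⁻¹) {z : ℂ} (hz : 0 < z.re) :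
    ‖∫ r in Set.Ioi δ, (r : ℂ) ^ (-z) • g r‖ ≤ C * (δ ^ (-z.re) / z.re) := by
  have h1 : IntegrableOn (fun r : ℝ => C * r ^ (-z.re - 1)) (Set.Ioi δ) :=
    (integrableOn_Ioi_rpow_of_lt (by linarith) hδ).const_mul C
  have h2 : ∫ r in Set.Ioi δ, C * r ^ (-z.re - 1) = C * (δ ^ (-z.re) / z.re) := by
    rw [integral_const_mul, integral_Ioi_rpow_of_lt (by linarith) hδ, sub_add_cancel, div_neg,
      neg_div, neg_neg]
  rw [← h2]
  refine norm_integral_le_of_norm_le h1 ?_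
  refine (ae_restrict_iff' measurableSet_Ioi).2 (Eventually.of_forall fun r hr => ?_)
  have hr0 : 0 < r := hδ.trans hr
  rw [norm_smul, Complex.norm_cpow_eq_rpow_re_of_pos hr0, Complex.neg_re,
      Real.rpow_sub_one hr0.ne']
  calc r ^ (-z.re) * ‖g r‖ ≤ r ^ (-z.re) * (C * r⁻¹) :=
        mul_le_mul_of_nonneg_left (hC r hr) (Real.rpow_nonneg hr0.le _)
    _ = _ := by ring

theorem differentiableAt_integral_ray [CompleteSpace X] {δ C : ℝ} (hδ : 0 < δ) {g : ℝ → X}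
    (hg : ContinuousOn g (Set.Ioi δ)) (hC : ∀ r, δ < r → ‖g r‖ ≤ C * r⁻¹) {z : ℂ}
    (hz : 0 < z.re) :
    DifferentiableAt ℂ (fun z : ℂ => ∫ r in Set.Ioi δ, (r : ℂ) ^ (-z) • g r) z := by
  -- Cut off at `δ`, the ray integral becomes a Mellin transform at `1 - z`, so its holomorphy is
  -- that of the Mellin transform.
  set f : ℝ → X := (Set.Ioi δ).indicator g with hf
  have h1 : (fun z : ℂ => ∫ r in Set.Ioi δ, (r : ℂ) ^ (-z) • g r) = fun z => mellin f (1 - z) := by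
    ext z
    rw [mellin, ← integral_indicator measurableSet_Ioi, ← integral_indicator measurableSet_Ioi]
    congr 1
    ext r
    by_cases hr : δ < r
    · rw [Set.indicator_of_mem (show r ∈ Set.Ioi δ from hr),
        Set.indicator_of_mem (show r ∈ Set.Ioi (0 : ℝ) from hδ.trans hr), hf,
        Set.indicator_of_mem (show r ∈ Set.Ioi δ from hr)]
      congr 2; ring
    · rw [Set.indicator_of_notMem (show r ∉ Set.Ioi δ from hr)]
      symm
      rw [Set.indicator_apply_eq_zero]
      intro _
      simp [hf, hr]
  have hfb : ∀ r, ‖f r‖ ≤ C * δ⁻¹ := by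
    have hC0 : 0 ≤ C * δ⁻¹ := by
      have h := (norm_nonneg _).trans (hC (δ + 1) (by linarith))
      have h3 : 0 < (δ + 1)⁻¹ := by positivity
      have : 0 ≤ C := nonneg_of_mul_nonneg_left h h3
      positivity
    intro r
    by_cases hr : δ < r
    · rw [hf, Set.indicator_of_mem (show r ∈ Set.Ioi δ from hr)]
      refine (hC r hr).trans ?_
      have : 0 ≤ C := nonneg_of_mul_nonneg_left hC0 (by positivity)
      gcongr
    · simpa [hf, hr] using hC0
  rw [h1]
  have h2 : DifferentiableAt ℂ (mellin f) (1 - z) := by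
    -- `a = 1` is the decay rate of `g`, and `1 - Re z < 1` is the hypothesis on `z`. As `f`
    -- vanishes near 0, any `b < 1 - Re z` would serve.
    refine mellin_differentiableAt_of_isBigO_rpow (a := 1) (b := -z.re) ?_ ?_ ?_ ?_ ?_
    · have hm : AEStronglyMeasurable f := by
        rw [hf, aestronglyMeasurable_indicator_iff measurableSet_Ioi]
        exact hg.aestronglyMeasurable measurableSet_Ioi
      refine LocallyIntegrable.locallyIntegrableOn ?_ _
      refine (locallyIntegrable_const (C * δ⁻¹)).mono hm (Eventually.of_forall fun r => ?_)
      exact (hfb r).trans (le_abs_self _)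
    · refine Asymptotics.IsBigO.of_bound C ?_
      filter_upwards [eventually_gt_atTop δ] with r hr
      rw [hf, Set.indicator_of_mem (show r ∈ Set.Ioi δ from hr), Real.rpow_neg_one,
        Real.norm_of_nonneg (inv_nonneg.2 (hδ.trans hr).le)]
      exact hC r hr
    · simpa using hz
    · refine Asymptotics.IsBigO.of_bound 0 ?_
      filter_upwards [mem_nhdsWithin_of_mem_nhds (Iio_mem_nhds hδ)] with r hr
      rw [hf, Set.indicator_of_notMem (by simpa using (le_of_lt hr : r ≤ δ))]
      simp
    · simp
  exact DifferentiableAt.comp (g := mellin f) (f := fun z : ℂ => 1 - z) z h2 (by fun_prop)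

theorem norm_integral_arc_le {a C : ℝ} (ha : 0 ≤ a) {g : ℝ → X}
    (hC : ∀ t ∈ Set.Icc (-a) a, ‖g t‖ ≤ C) (z : ℂ) :
    ‖∫ t in (-a)..a, Complex.exp (-z * t * Complex.I) • g t‖
      ≤ Real.exp (a * |z.im|) * C * (2 * a) := by
  refine (intervalIntegral.norm_integral_le_of_norm_le_const
    (C := Real.exp (a * |z.im|) * C) fun t ht => ?_).trans_eq ?_
  · rw [Set.uIoc_of_le (by linarith)] at ht
    rw [norm_smul, Complex.norm_exp]
    have hg := hC t ⟨ht.1.le, ht.2⟩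
    have h1 : (-z * t * Complex.I).re = z.im * t := by simp
    have h2 : z.im * t ≤ a * |z.im| := by
      calc z.im * t ≤ |z.im| * |t| := by rw [← abs_mul]; exact le_abs_self _
        _ ≤ |z.im| * a := by gcongr; exact abs_le.2 ⟨ht.1.le, ht.2⟩
        _ = _ := mul_comm _ _
    rw [h1]
    gcongr
  · rw [sub_neg_eq_add, abs_of_nonneg (a := a + a) (by linarith)]; ring

theorem differentiable_integral_arc {a : ℝ} (ha : 0 ≤ a) {g : ℝ → X}
    (hg : ContinuousOn g (Set.Icc (-a) a)) :
    Differentiable ℂ (fun z : ℂ => ∫ t in (-a)..a, Complex.exp (-z * t * Complex.I) • g t) := by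
  intro z
  obtain ⟨C, hC⟩ := isCompact_Icc.exists_bound_of_continuousOn hg
  have hI : ∀ t ∈ Set.uIoc (-a) a, t ∈ Set.Icc (-a) a := fun t ht => by
    rw [Set.uIoc_of_le (by linarith)] at ht; exact ⟨ht.1.le, ht.2⟩
  have hcont : ∀ (f : ℝ → ℂ), Continuous f →
      ContinuousOn (fun t => f t • g t) (Set.uIcc (-a) a) := fun f hf => by
    rw [Set.uIcc_of_le (by linarith)]
    exact hf.continuousOn.smul hg
  have hmeas : ∀ (f : ℝ → ℂ), Continuous f →
      AEStronglyMeasurable (fun t => f t • g t) (volume.restrict (Set.uIoc (-a) a)) :=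
    fun f hf => ((hcont f hf).mono Set.uIoc_subset_uIcc).aestronglyMeasurable
      measurableSet_uIoc
  refine (intervalIntegral.hasDerivAt_integral_of_dominated_loc_of_deriv_le
    (F' := fun z t => (Complex.exp (-z * t * Complex.I) * (-t * Complex.I)) • g t)
    (bound := fun _ => Real.exp (a * (|z.im| + 1)) * a * C) (Metric.ball_mem_nhds z one_pos)
    (Eventually.of_forall fun w => hmeas _ (by fun_prop)) (hcont _ (by fun_prop)).intervalIntegrable
    (hmeas _ (by fun_prop)) ?_ (by simp) ?_).2.differentiableAt
  · refine Eventually.of_forall fun t ht w hw => ?_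
    have ht' := hI t ht
    have hta : |t| ≤ a := abs_le.2 ht'
    have hw' : |w.im| ≤ |z.im| + 1 := by
      have h1 : |(w - z).im| < 1 := (Complex.abs_im_le_norm _).trans_lt (by simpa [dist_eq_norm] using hw)
      have h2 : |w.im| ≤ |z.im| + |(w - z).im| := by
        have := abs_add_le z.im (w - z).im
        simpa using this
      linarith
    rw [norm_smul, norm_mul, Complex.norm_exp]
    have h1 : (-w * t * Complex.I).re = w.im * t := by simp
    have h2 : w.im * t ≤ a * (|z.im| + 1) := by
      calc w.im * t ≤ |w.im| * |t| := by rw [← abs_mul]; exact le_abs_self _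
        _ ≤ (|z.im| + 1) * a := by gcongr
        _ = _ := mul_comm _ _
    have h3 : ‖-(t : ℂ) * Complex.I‖ ≤ a := by simpa using hta
    rw [h1]
    gcongr
    exact hC t ht'
  · refine Eventually.of_forall fun t ht w hw => ?_
    have : HasDerivAt (fun w : ℂ => Complex.exp (-w * t * Complex.I))
        (Complex.exp (-w * t * Complex.I) * (-t * Complex.I)) w := by
      have h : HasDerivAt (fun w : ℂ => -w * t * Complex.I) (-t * Complex.I) w := by
        simpa using (((hasDerivAt_id w).neg).mul_const (t : ℂ)).mul_const Complex.I
      exact h.cexp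
    exact this.smul_const _

end PowerIntegrals

theorem apply_of_eq_ofBounded {E F : Type*} [NormedAddCommGroup E] [InnerProductSpace ℂ E]
    [NormedAddCommGroup F] [InnerProductSpace ℂ F] {A : E →ₗ.[ℂ] F} {B : E →L[ℂ] F}
    (h : A = ofBounded B) (x : E) (hx : x ∈ A.domain) : A ⟨x, hx⟩ = B x := by
  subst h
  rfl

/-! ### Sectors and admissible contours -/

/-- The argument is not continuous, so the closure is handled through a closed inequality valid on
the sector; it also covers the half-line `ω = 0`. -/
theorem norm_mul_cos_le_of_mem_closure_sector {ω : ℝ} (hπ : ω ≤ Real.pi) {z : ℂ}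
    (hz : z ∈ closure (sector ω)) : ‖z‖ * Real.cos ω ≤ z.re := by
  have hcl : IsClosed {z : ℂ | ‖z‖ * Real.cos ω ≤ z.re} :=
    isClosed_le (by fun_prop) (by fun_prop)
  refine closure_minimal (fun w hw => ?_) hcl hz
  by_cases hω : ω = 0
  · rw [sector, if_pos hω] at hw
    have : w = (w.re : ℂ) := by apply Complex.ext <;> simp [hw.2]
    simp only [Set.mem_ofPred_eq, hω, Real.cos_zero, mul_one]
    rw [this, Complex.norm_real, Real.norm_of_nonneg hw.1.le, Complex.ofReal_re]
  · rw [sector, if_neg hω] at hw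
    have h1 : Real.cos ω ≤ Real.cos w.arg := by
      rw [← Real.cos_abs w.arg]
      exact Real.cos_le_cos_of_nonneg_of_le_pi (abs_nonneg _) hπ hw.2.le
    have h2 := Complex.norm_mul_cos_arg w
    simp only [Set.mem_ofPred_eq]
    rw [← h2]
    gcongr

theorem ray_notMem_closure_sector {ω ψ r : ℝ} (h0 : 0 ≤ ω) (hψ : ω < |ψ|) (hπ : |ψ| ≤ Real.pi)
    (hr : 0 < r) : (r : ℂ) * Complex.exp (ψ * Complex.I) ∉ closure (sector ω) := by
  intro h
  have h1 := norm_mul_cos_le_of_mem_closure_sector (hψ.le.trans hπ) h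
  have h2 : Real.cos ψ < Real.cos ω := by
    rw [← Real.cos_abs ψ]
    exact Real.cos_lt_cos_of_nonneg_of_le_pi h0 hπ hψ
  rw [norm_mul, Complex.norm_real, Complex.norm_exp_ofReal_mul_I, Real.norm_of_nonneg hr.le,
    Complex.re_ofReal_mul, Complex.exp_ofReal_mul_I_re, mul_one] at h1
  exact absurd (le_of_mul_le_mul_left h1 hr) (not_le.2 h2)

/-! ### The Dunford integral along an admissible contour -/

section Contour

variable {H : Type*} [NormedAddCommGroup H] [InnerProductSpace ℂ H] {T : H →ₗ.[ℂ] H} {φ δ : ℝ}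

theorem IsAdmissibleContour.angle_pos (hc : IsAdmissibleContour T φ δ) : 0 < φ := by
  obtain ⟨ω, h1, h2⟩ := hc.angle
  exact h2.angle_nonneg.trans_lt h1

theorem IsAdmissibleContour.ray_mem (hc : IsAdmissibleContour T φ δ) {ψ r : ℝ} (hψ : |ψ| = φ)
    (hr : 0 < r) : (r : ℂ) * Complex.exp (ψ * Complex.I) ∈ resSet T := by
  obtain ⟨ω, h1, h2⟩ := hc.angle
  by_contra h
  exact ray_notMem_closure_sector h2.angle_nonneg (hψ ▸ h1) (hψ ▸ hc.angle_lt_pi.le) hr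
    (h2.spectrum_subset h)

theorem IsAdmissibleContour.exists_ray_bound (hc : IsAdmissibleContour T φ δ) :
    ∃ C : ℝ, ∀ ψ r : ℝ, |ψ| = φ → 0 < r →
      ‖resolvent T ((r : ℂ) * Complex.exp (ψ * Complex.I))‖ ≤ C * r⁻¹ := by
  obtain ⟨ω, h1, h2⟩ := hc.angle
  have hπ := hc.angle_lt_pi
  have h0 := h2.angle_nonneg
  -- The bound holds off a closed sector of angle larger than `ω`; the midpoint leaves the rays of
  -- angle `φ` outside that sector.
  obtain ⟨C, hC⟩ := h2.resolvent_bound ((ω + φ) / 2) (by linarith) (by linarith)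
  refine ⟨C, fun ψ r hψ hr => ?_⟩
  have h3 := hC _ (ray_notMem_closure_sector (ω := (ω + φ) / 2) (ψ := ψ) (by linarith)
    (by rw [hψ]; linarith) (hψ ▸ hπ.le) hr)
  rw [norm_smul, norm_mul, Complex.norm_real, Complex.norm_exp_ofReal_mul_I,
    Real.norm_of_nonneg hr.le, mul_one] at h3
  rw [← div_eq_mul_inv, le_div_iff₀ hr, mul_comm]
  exact h3

theorem IsAdmissibleContour.arc_mem (hc : IsAdmissibleContour T φ δ) (t : ℝ) :
    (δ : ℂ) * Complex.exp (t * Complex.I) ∈ resSet T := by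
  refine hc.ball_subset ?_
  rw [mem_closedBall_zero_iff, norm_mul, Complex.norm_real, Complex.norm_exp_ofReal_mul_I,
    Real.norm_of_nonneg hc.radius_pos.le, mul_one]

theorem exists_isAdmissibleContour [CompleteSpace H] (hT : IsSectorial T)
    (h0 : (0 : ℂ) ∈ resSet T) : ∃ c : ℝ × ℝ, IsAdmissibleContour T c.1 c.2 := by
  obtain ⟨ω, hω⟩ := hT
  obtain ⟨δ, hδ, hb⟩ := Metric.nhds_basis_closedBall.mem_iff.1 ((isOpen_resSet T).mem_nhds h0)
  have := hω.angle_lt_pi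
  exact ⟨((ω + Real.pi) / 2, δ), ⟨ω, by dsimp only; linarith, hω⟩, by dsimp only; linarith, hδ, hb⟩

/-- The integral of `r^{-z} (T - r e^{iψ})⁻¹` over `r > δ`. -/
def rayIntegral (T : H →ₗ.[ℂ] H) (δ ψ : ℝ) (z : ℂ) : H →L[ℂ] H :=
  ∫ r in Set.Ioi δ, (r : ℂ) ^ (-z) • resolvent T (r * Complex.exp (ψ * Complex.I))

/-- The integral of `e^{-izt} e^{it} (T - δ e^{it})⁻¹` over `|t| ≤ φ`. -/
def arcIntegral (T : H →ₗ.[ℂ] H) (φ δ : ℝ) (z : ℂ) : H →L[ℂ] H :=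
  ∫ t in (-φ)..φ, Complex.exp (-z * t * Complex.I) •
    (Complex.exp (t * Complex.I) • resolvent T (δ * Complex.exp (t * Complex.I)))

theorem integral_ray_eq_smul_rayIntegral (T : H →ₗ.[ℂ] H) {ψ : ℝ} (hδ : 0 < δ) (hψ : |ψ| < Real.pi)
    (z : ℂ) :
    (∫ r in Set.Ioi δ, Complex.exp (ψ * Complex.I) •
      (((r : ℂ) * Complex.exp (ψ * Complex.I)) ^ (-z) •
        resolvent T (r * Complex.exp (ψ * Complex.I))))
      = Complex.exp ((1 - z) * ψ * Complex.I) • rayIntegral T δ ψ z := by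
  rw [rayIntegral, ← integral_smul]
  refine setIntegral_congr_fun measurableSet_Ioi fun r hr => ?_
  rw [ofReal_mul_exp_cpow (hδ.trans hr) hψ, smul_smul, smul_smul]
  congr 1
  have : Complex.exp ((1 - z) * ψ * Complex.I)
      = Complex.exp (ψ * Complex.I) * Complex.exp (-z * ψ * Complex.I) := by
    rw [← Complex.exp_add]; ring_nf
  rw [this]; ring

/-- Splitting `ζ^{-z}` into modulus and phase on each piece pulls the phases (on the arc, the
modulus) out of the integrals. Holomorphy, growth and the shift rule can then be checked piece by
piece. -/
theorem dunfordIntegral_eq (hc : IsAdmissibleContour T φ δ) (z : ℂ) :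
    dunfordIntegral T φ δ z = (2 * Real.pi * Complex.I)⁻¹ •
      (-(Complex.exp ((1 - z) * (-φ : ℝ) * Complex.I) • rayIntegral T δ (-φ) z)
        + (Complex.I * δ * (δ : ℂ) ^ (-z)) • arcIntegral T φ δ z
        + Complex.exp ((1 - z) * φ * Complex.I) • rayIntegral T δ φ z) := by
  have hφ := hc.angle_pos
  have hπ : |φ| < Real.pi := by rw [abs_of_pos hφ]; exact hc.angle_lt_pi
  rw [← integral_ray_eq_smul_rayIntegral T hc.radius_pos hπ,
    ← integral_ray_eq_smul_rayIntegral T hc.radius_pos (by rwa [abs_neg]), dunfordIntegral]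
  congr 3
  rw [arcIntegral, ← intervalIntegral.integral_smul]
  refine intervalIntegral.integral_congr fun t ht => ?_
  rw [Set.uIcc_of_le (by linarith)] at ht
  have ht' : |t| < Real.pi := (abs_le.2 ht).trans_lt hc.angle_lt_pi
  dsimp only
  rw [ofReal_mul_exp_cpow hc.radius_pos ht', smul_smul, smul_smul, smul_smul]
  congr 1
  ring

variable [CompleteSpace H]

theorem IsAdmissibleContour.continuousOn_ray (hc : IsAdmissibleContour T φ δ) {ψ : ℝ}
    (hψ : |ψ| = φ) :
    ContinuousOn (fun r : ℝ => resolvent T (r * Complex.exp (ψ * Complex.I))) (Set.Ioi δ) :=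
  (continuousOn_resolvent T).comp (by fun_prop) fun _ hr => hc.ray_mem hψ (hc.radius_pos.trans hr)

theorem IsAdmissibleContour.continuous_arc (hc : IsAdmissibleContour T φ δ) :
    Continuous (fun t : ℝ => resolvent T (δ * Complex.exp (t * Complex.I))) :=
  (continuousOn_resolvent T).comp_continuous (by fun_prop) hc.arc_mem

theorem differentiableAt_dunfordIntegral (hc : IsAdmissibleContour T φ δ) {z : ℂ} (hz : 0 < z.re) :
    DifferentiableAt ℂ (dunfordIntegral T φ δ) z := by
  have hφ := hc.angle_pos
  obtain ⟨C, hC⟩ := hc.exists_ray_bound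
  have hray : ∀ ψ : ℝ, |ψ| = φ → DifferentiableAt ℂ (rayIntegral T δ ψ) z := fun ψ hψ =>
    differentiableAt_integral_ray hc.radius_pos (hc.continuousOn_ray hψ)
      (fun r hr => hC ψ r hψ (hc.radius_pos.trans hr)) hz
  have h1 := hray φ (abs_of_pos hφ)
  have h2 := hray (-φ) (by rw [abs_neg, abs_of_pos hφ])
  have h3 : DifferentiableAt ℂ (arcIntegral T φ δ) z := by
    refine (differentiable_integral_arc hφ.le (Continuous.continuousOn ?_)).differentiableAt
    have := hc.continuous_arc
    fun_prop
  have hδ : (δ : ℂ) ≠ 0 := by exact_mod_cast hc.radius_pos.ne'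
  have h4 : DifferentiableAt ℂ (fun z : ℂ => (δ : ℂ) ^ (-z)) z :=
    DifferentiableAt.const_cpow (by fun_prop) (Or.inl hδ)
  have : dunfordIntegral T φ δ = _ := funext (dunfordIntegral_eq hc)
  rw [this]
  fun_prop

/-- Any exponential rate will do, since a Gaussian factor is inserted later; `π` bounds every angle
on the contour. The range `1 ≤ Re z ≤ 2` is where `w + 1` and `2 - w` lie for `w` in the closed unit
strip. -/
theorem exists_norm_dunfordIntegral_le (hc : IsAdmissibleContour T φ δ) :
    ∃ C : ℝ, ∀ z : ℂ, 1 ≤ z.re → z.re ≤ 2 →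
      ‖dunfordIntegral T φ δ z‖ ≤ C * Real.exp (Real.pi * |z.im|) := by
  have hφ := hc.angle_pos
  have hδ := hc.radius_pos
  obtain ⟨C₁, hC₁⟩ := hc.exists_ray_bound
  obtain ⟨C₂, hC₂⟩ := (isCompact_Icc (a := -φ) (b := φ)).exists_bound_of_continuousOn
    (f := fun t : ℝ => Complex.exp (t * Complex.I) •
      resolvent T (δ * Complex.exp (t * Complex.I)))
    (Continuous.continuousOn (by have := hc.continuous_arc; fun_prop))
  have hC₁0 : 0 ≤ C₁ := by
    have := (norm_nonneg _).trans (hC₁ φ 1 (abs_of_pos hφ) one_pos)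
    simpa using this
  have hC₂0 : 0 ≤ C₂ := (norm_nonneg _).trans (hC₂ 0 ⟨by linarith, hφ.le⟩)
  -- The two endpoint values of `δ^{-Re z}`; their sum dominates it whether `δ` is below or above 1.
  set D : ℝ := δ⁻¹ + δ ^ (-2 : ℝ) with hD
  have hD0 : 0 ≤ D := by positivity
  have hDle : ∀ z : ℂ, 1 ≤ z.re → z.re ≤ 2 → δ ^ (-z.re) ≤ D := by
    intro z h1 h2
    rcases le_total δ 1 with h | h
    · have : δ ^ (-z.re) ≤ δ ^ (-2 : ℝ) :=
        Real.rpow_le_rpow_of_exponent_ge hδ h (by linarith)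
      have h' : 0 < δ⁻¹ := by positivity
      linarith
    · have : δ ^ (-z.re) ≤ δ ^ (-1 : ℝ) := Real.rpow_le_rpow_of_exponent_le h (by linarith)
      rw [Real.rpow_neg_one] at this
      have h' : 0 < δ ^ (-2 : ℝ) := by positivity
      linarith
  refine ⟨‖(2 * Real.pi * Complex.I : ℂ)⁻¹‖ * (C₁ * D + δ * D * (C₂ * (2 * φ)) + C₁ * D),
    fun z h1 h2 => ?_⟩
  set e := Real.exp (Real.pi * |z.im|) with he
  have hray : ∀ ψ : ℝ, |ψ| = φ →
      ‖Complex.exp ((1 - z) * ψ * Complex.I) • rayIntegral T δ ψ z‖ ≤ C₁ * D * e := by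
    intro ψ hψ
    have h3 : ‖rayIntegral T δ ψ z‖ ≤ C₁ * D := by
      refine (norm_integral_ray_le hδ (fun r hr => hC₁ ψ r hψ (hδ.trans hr)) (by linarith)).trans ?_
      gcongr
      refine (div_le_self (by positivity) h1).trans (hDle z h1 h2)
    have h4 : ‖Complex.exp ((1 - z) * ψ * Complex.I)‖ ≤ e := by
      rw [Complex.norm_exp, he]
      gcongr
      have h5 : ((1 - z) * ψ * Complex.I).re = ψ * z.im := by simp; ring
      rw [h5]
      refine (le_abs_self _).trans ?_
      rw [abs_mul, hψ]
      gcongr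
      exact hc.angle_lt_pi.le
    rw [norm_smul, mul_comm]
    gcongr
  have harc : ‖(Complex.I * δ * (δ : ℂ) ^ (-z)) • arcIntegral T φ δ z‖
      ≤ δ * D * (C₂ * (2 * φ)) * e := by
    have h3 : ‖arcIntegral T φ δ z‖ ≤ e * C₂ * (2 * φ) := by
      refine (norm_integral_arc_le hφ.le hC₂ z).trans ?_
      rw [he]
      have := hc.angle_lt_pi.le
      gcongr
    have h4 : ‖Complex.I * δ * (δ : ℂ) ^ (-z)‖ ≤ δ * D := by
      rw [norm_mul, norm_mul, Complex.norm_I, Complex.norm_real, Real.norm_of_nonneg hδ.le, one_mul,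
        Complex.norm_cpow_eq_rpow_re_of_pos hδ, Complex.neg_re]
      gcongr
      exact hDle z h1 h2
    rw [norm_smul]
    calc _ ≤ (δ * D) * (e * C₂ * (2 * φ)) := by gcongr
      _ = _ := by ring
  rw [dunfordIntegral_eq hc, norm_smul]
  have h6 := hray φ (abs_of_pos hφ)
  have h7 := hray (-φ) (by rw [abs_neg, abs_of_pos hφ])
  rw [mul_assoc ‖(2 * Real.pi * Complex.I : ℂ)⁻¹‖]
  refine mul_le_mul_of_nonneg_left ?_ (norm_nonneg _)
  refine (norm_add_le _ _).trans ?_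
  refine (add_le_add (norm_add_le _ _) le_rfl).trans ?_
  rw [norm_neg]
  calc _ ≤ C₁ * D * e + δ * D * (C₂ * (2 * φ)) * e + C₁ * D * e := by gcongr
    _ = _ := by ring

/-! ### Multiplication by the inverse raises the exponent by one -/

theorem map_rayIntegral (hc : IsAdmissibleContour T φ δ) {ψ : ℝ} (hψ : |ψ| = φ) {Q : H →L[ℂ] H}
    (L : (H →L[ℂ] H) →L[ℂ] (H →L[ℂ] H))
    (hL : ∀ ζ ∈ resSet T, ζ ≠ 0 → L (resolvent T ζ) = ζ⁻¹ • (resolvent T ζ - Q)) {z : ℂ}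
    (hz : 0 < z.re) :
    L (rayIntegral T δ ψ z) = Complex.exp (-ψ * Complex.I) •
      (rayIntegral T δ ψ (z + 1) - ((δ : ℂ) ^ (-z) / z) • Q) := by
  have hδ := hc.radius_pos
  obtain ⟨C, hC⟩ := hc.exists_ray_bound
  have hint : ∀ {w : ℂ}, 0 < w.re → IntegrableOn (fun r : ℝ => (r : ℂ) ^ (-w) •
      resolvent T (r * Complex.exp (ψ * Complex.I))) (Set.Ioi δ) := fun hw =>
    integrableOn_ray hδ (hc.continuousOn_ray hψ) (fun r hr => hC ψ r hψ (hδ.trans hr)) hw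
  have h1 : (-(z + 1)).re < -1 := by simp; linarith
  have h2 : (∫ r in Set.Ioi δ, (r : ℂ) ^ (-(z + 1))) = (δ : ℂ) ^ (-z) / z := by
    rw [integral_Ioi_cpow_of_lt h1 hδ]
    have : -(z + 1) + 1 = -z := by ring
    rw [this, neg_div_neg_eq]
  rw [rayIntegral, ← L.integral_comp_comm (hint hz), ← h2, ← integral_smul_const, rayIntegral,
    ← integral_sub (hint (by simp; linarith)) ((integrableOn_Ioi_cpow_of_lt h1 hδ).smul_const Q),
    ← integral_smul]
  refine setIntegral_congr_fun measurableSet_Ioi fun r hr => ?_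
  have hr0 : 0 < r := hδ.trans hr
  have hr' : (r : ℂ) ≠ 0 := by exact_mod_cast hr0.ne'
  rw [map_smul, hL _ (hc.ray_mem hψ hr0) (mul_ne_zero hr' (Complex.exp_ne_zero _)), ← smul_sub,
    smul_smul, smul_smul]
  congr 1
  rw [mul_inv, ← Complex.exp_neg, neg_add, Complex.cpow_add _ _ hr', Complex.cpow_neg_one, neg_mul]
  ring

theorem map_arcIntegral (hc : IsAdmissibleContour T φ δ) {Q : H →L[ℂ] H}
    (L : (H →L[ℂ] H) →L[ℂ] (H →L[ℂ] H))
    (hL : ∀ ζ ∈ resSet T, ζ ≠ 0 → L (resolvent T ζ) = ζ⁻¹ • (resolvent T ζ - Q)) {z : ℂ}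
    (hz : z ≠ 0) :
    L (arcIntegral T φ δ z) = (δ : ℂ)⁻¹ • (arcIntegral T φ δ (z + 1) -
      ((Complex.exp (-z * φ * Complex.I) - Complex.exp (z * φ * Complex.I)) / (-z * Complex.I))
        • Q) := by
  have hδ : (δ : ℂ) ≠ 0 := by exact_mod_cast hc.radius_pos.ne'
  have hcont := hc.continuous_arc
  have h1 : (∫ t in (-φ)..φ, Complex.exp (-z * Complex.I * t))
      = (Complex.exp (-z * φ * Complex.I) - Complex.exp (z * φ * Complex.I)) / (-z * Complex.I) := by
    rw [integral_exp_mul_complex (mul_ne_zero (neg_ne_zero.2 hz) Complex.I_ne_zero)]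
    congr 3 <;> · push_cast; ring
  rw [arcIntegral, ← L.intervalIntegral_comp_comm
      (Continuous.intervalIntegrable (by fun_prop) _ _), ← h1,
    ← intervalIntegral.integral_smul_const, arcIntegral,
    ← intervalIntegral.integral_sub (Continuous.intervalIntegrable (by fun_prop) _ _)
      (Continuous.intervalIntegrable (by fun_prop) _ _), ← intervalIntegral.integral_smul]
  refine intervalIntegral.integral_congr fun t ht => ?_
  rw [map_smul, map_smul, hL _ (hc.arc_mem t) (mul_ne_zero hδ (Complex.exp_ne_zero _)), smul_smul,
    smul_smul, smul_smul]
  have h2 : Complex.exp (-(z + 1) * t * Complex.I) * Complex.exp (t * Complex.I)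
      = Complex.exp (-z * Complex.I * t) := by rw [← Complex.exp_add]; ring_nf
  rw [h2, ← smul_sub, smul_smul]
  congr 1
  rw [mul_inv, ← Complex.exp_neg, ← h2, mul_comm (δ : ℂ)⁻¹, mul_assoc, ← mul_assoc (Complex.exp (t * Complex.I)), ← Complex.exp_add,
    ← Complex.exp_add, add_neg_cancel, Complex.exp_zero]
  ring_nf

/-- `L` stands for left or right multiplication by `Q = T⁻¹`, and `hL` is the resolvent identity at
0. The extra term is `Q` times the contour integral of `ζ^{-z-1}`, which vanishes because
`-ζ^{-z}/z` is a primitive that tends to 0 along both rays. -/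
theorem map_dunfordIntegral (hc : IsAdmissibleContour T φ δ) {Q : H →L[ℂ] H}
    (L : (H →L[ℂ] H) →L[ℂ] (H →L[ℂ] H))
    (hL : ∀ ζ ∈ resSet T, ζ ≠ 0 → L (resolvent T ζ) = ζ⁻¹ • (resolvent T ζ - Q)) {z : ℂ}
    (hz : 0 < z.re) : L (dunfordIntegral T φ δ z) = dunfordIntegral T φ δ (z + 1) := by
  have hφ := hc.angle_pos
  have hδ : (δ : ℂ) ≠ 0 := by exact_mod_cast hc.radius_pos.ne'
  have hz0 : z ≠ 0 := fun h => by simp [h] at hz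
  rw [dunfordIntegral_eq hc, dunfordIntegral_eq hc, map_smul, map_add, map_add, map_neg, map_smul,
    map_smul, map_smul, map_arcIntegral hc L hL hz0, map_rayIntegral hc (abs_of_pos hφ) L hL hz,
    map_rayIntegral hc (by rw [abs_neg, abs_of_pos hφ]) L hL hz]
  congr 1
  have e1 : Complex.exp ((1 - z) * φ * Complex.I) * Complex.exp (-φ * Complex.I)
      = Complex.exp (-z * φ * Complex.I) := by rw [← Complex.exp_add]; ring_nf
  have e2 : Complex.exp ((1 - z) * (-φ : ℝ) * Complex.I) * Complex.exp (-(-φ : ℝ) * Complex.I)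
      = Complex.exp (z * φ * Complex.I) := by rw [← Complex.exp_add]; push_cast; ring_nf
  have e3 : Complex.exp ((1 - (z + 1)) * φ * Complex.I) = Complex.exp (-z * φ * Complex.I) := by
    ring_nf
  have e4 : Complex.exp ((1 - (z + 1)) * (-φ : ℝ) * Complex.I) = Complex.exp (z * φ * Complex.I) := by
    push_cast; ring_nf
  have e5 : Complex.I * δ * (δ : ℂ) ^ (-(z + 1)) = Complex.I * (δ : ℂ) ^ (-z) := by
    rw [neg_add, Complex.cpow_add _ _ hδ, Complex.cpow_neg_one]; field_simp
  have e6 : Complex.I * δ * (δ : ℂ) ^ (-z) * (δ : ℂ)⁻¹ = Complex.I * (δ : ℂ) ^ (-z) := by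
    field_simp
  rw [smul_smul, smul_smul, smul_smul, e1, e2, e3, e4, e5, e6]
  generalize Complex.exp (-z * φ * Complex.I) = a
  generalize Complex.exp (z * φ * Complex.I) = b
  generalize (δ : ℂ) ^ (-z) = d
  -- The coefficient of `Q` from the arc, written so as to cancel the two corner terms of the rays.
  have e7 : Complex.I * d * ((a - b) / (-z * Complex.I)) = b * (d / z) - a * (d / z) := by
    have := Complex.I_ne_zero
    field_simp
    ring
  simp only [smul_sub, smul_smul, e7, sub_smul]
  abel

end Contour

/-! ### Negative powers -/

section Powers

variable {H : Type*} [NormedAddCommGroup H] [InnerProductSpace ℂ H]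
  {T : H →ₗ.[ℂ] H} {Q : H →L[ℂ] H}

theorem tendsto_dunfordPow_approach {s : ℝ} {B : H →L[ℂ] H} (hB : imagPow T s = ofBounded B)
    (f : H) : Tendsto (fun w => dunfordPow T w f) (approach s) (𝓝 (B f)) := by
  have hf : f ∈ (imagPow T s).domain := by rw [hB]; trivial
  rw [← apply_of_eq_ofBounded hB f hf]
  exact Exists.choose_spec (p := fun g => Tendsto (fun w => dunfordPow T w f) (approach s) (𝓝 g)) hf

variable [CompleteSpace H]

/-- The contour chosen in `dunfordPow` does not depend on `z`, so one contour serves the whole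
family and contour independence is never invoked. -/
theorem exists_dunfordPow_eq (hT : IsSectorial T) (h0 : (0 : ℂ) ∈ resSet T) :
    ∃ φ δ : ℝ, IsAdmissibleContour T φ δ ∧ dunfordPow T = dunfordIntegral T φ δ := by
  have h := exists_isAdmissibleContour hT h0
  refine ⟨h.choose.1, h.choose.2, h.choose_spec, ?_⟩
  ext1 z
  rw [dunfordPow, dif_pos h]

theorem differentiableAt_dunfordPow (hT : IsSectorial T) (h0 : (0 : ℂ) ∈ resSet T) {z : ℂ}
    (hz : 0 < z.re) : DifferentiableAt ℂ (dunfordPow T) z := by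
  obtain ⟨φ, δ, hc, h⟩ := exists_dunfordPow_eq hT h0
  rw [h]
  exact differentiableAt_dunfordIntegral hc hz

theorem exists_norm_dunfordPow_le (hT : IsSectorial T) (h0 : (0 : ℂ) ∈ resSet T) :
    ∃ C : ℝ, ∀ z : ℂ, 1 ≤ z.re → z.re ≤ 2 →
      ‖dunfordPow T z‖ ≤ C * Real.exp (Real.pi * |z.im|) := by
  obtain ⟨φ, δ, hc, h⟩ := exists_dunfordPow_eq hT h0
  rw [h]
  exact exists_norm_dunfordIntegral_le hc

theorem inverse_mul_dunfordPow (hT : IsSectorial T) (hQ : IsResolventAt T 0 Q) {z : ℂ}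
    (hz : 0 < z.re) : Q * dunfordPow T z = dunfordPow T (z + 1) := by
  obtain ⟨φ, δ, hc, h⟩ := exists_dunfordPow_eq hT ⟨Q, hQ⟩
  rw [h]
  exact map_dunfordIntegral hc (ContinuousLinearMap.mul ℂ (H →L[ℂ] H) Q)
    (fun ζ hζ h0 => (isResolventAt_resolvent hζ).zero_mul hQ h0) hz

theorem dunfordPow_mul_inverse (hT : IsSectorial T) (hQ : IsResolventAt T 0 Q) {z : ℂ}
    (hz : 0 < z.re) : dunfordPow T z * Q = dunfordPow T (z + 1) := by
  obtain ⟨φ, δ, hc, h⟩ := exists_dunfordPow_eq hT ⟨Q, hQ⟩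
  rw [h]
  exact map_dunfordIntegral hc ((ContinuousLinearMap.mul ℂ (H →L[ℂ] H)).flip Q)
    (fun ζ hζ h0 => (isResolventAt_resolvent hζ).mul_zero hQ h0) hz

/-- For an invertible sectorial operator with bounded imaginary powers, the powers `T^{-z}`,
`Re z ≥ 0`, are bounded operators `V z` such that `T⁻¹ V z = V z T⁻¹ = T^{-(z + 1)}`. -/
theorem HasBIP.exists_bounded_powers {N θ : ℝ} (hBIP : HasBIP T N θ) (hT : IsSectorial T)
    (hQ : IsResolventAt T 0 Q) :
    ∃ V : ℂ → H →L[ℂ] H, (∀ z : ℂ, 0 ≤ z.re → negPow T z = ofBounded (V z)) ∧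
      (∀ z : ℂ, 0 < z.re → V z = dunfordPow T z) ∧
      (∀ z : ℂ, 0 ≤ z.re → Q * V z = dunfordPow T (z + 1)) ∧
      (∀ z : ℂ, 0 ≤ z.re → V z * Q = dunfordPow T (z + 1)) ∧
      ∀ z : ℂ, z.re = 0 → ‖V z‖ ≤ N * Real.exp (θ * |z.im|) := by
  classical
  choose B hB hBn using hBIP.bounded
  -- On the imaginary axis `T^{-z} = T^{is}` with `s = -Im z`.
  set V : ℂ → H →L[ℂ] H := fun z => if 0 < z.re then dunfordPow T z else B (-z.im) with hV
  have hVpos : ∀ z : ℂ, 0 < z.re → V z = dunfordPow T z := fun z hz => if_pos hz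
  have hVzero : ∀ z : ℂ, z.re = 0 → V z = B (-z.im) := fun z hz => if_neg (by rw [hz]; simp)
  -- After the shift the limit is taken inside the half-plane of holomorphy, so the product rules
  -- survive the strong limit defining `T^{is}`.
  have hlim : ∀ (z : ℂ), z.re = 0 → ∀ f, Tendsto (fun w => dunfordPow T (w + 1) f)
      (approach (-z.im)) (𝓝 (dunfordPow T (z + 1) f)) := by
    intro z hz f
    have h1 : -(Complex.I * ((-z.im : ℝ) : ℂ)) = z := by
      apply Complex.ext <;> simp [hz]
    have h2 : ContinuousAt (fun w => dunfordPow T (w + 1) f) z := by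
      have h3 : ContinuousAt (dunfordPow T) (z + 1) :=
        (differentiableAt_dunfordPow hT ⟨Q, hQ⟩ (by simp [hz])).continuousAt
      have h4 : ContinuousAt (fun w => dunfordPow T (w + 1)) z :=
        ContinuousAt.comp (g := dunfordPow T) (f := fun w => w + 1) h3 (by fun_prop)
      exact h4.clm_apply continuousAt_const
    rw [approach, h1]
    exact h2.tendsto.mono_left nhdsWithin_le_nhds
  have hpos : ∀ s : ℝ, ∀ᶠ w in approach s, 0 < w.re := fun s => self_mem_nhdsWithin
  refine ⟨V, fun z hz => ?_, hVpos, fun z hz => ?_, fun z hz => ?_, fun z hz => ?_⟩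
  · rcases hz.lt_or_eq with h | h
    · rw [negPow, if_pos h, hVpos z h]
    · rw [negPow, if_neg (by rw [← h]; simp), hVzero z h.symm, hB]
  · rcases hz.lt_or_eq with h | h
    · rw [hVpos z h, inverse_mul_dunfordPow hT hQ h]
    · ext f
      refine tendsto_nhds_unique ?_ (hlim z h.symm f)
      rw [hVzero z h.symm, mul_apply_eq_comp]
      refine ((Q.continuous.tendsto _).comp (tendsto_dunfordPow_approach (hB (-z.im)) f)).congr' ?_
      filter_upwards [hpos (-z.im)] with w hw
      rw [← inverse_mul_dunfordPow hT hQ hw]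
      rfl
  · rcases hz.lt_or_eq with h | h
    · rw [hVpos z h, dunfordPow_mul_inverse hT hQ h]
    · ext f
      refine tendsto_nhds_unique ?_ (hlim z h.symm f)
      rw [hVzero z h.symm, mul_apply_eq_comp]
      refine (tendsto_dunfordPow_approach (hB (-z.im)) (Q f)).congr' ?_
      filter_upwards [hpos (-z.im)] with w hw
      rw [← dunfordPow_mul_inverse hT hQ hw]
      rfl
  · rw [hVzero z hz]
    simpa using hBn (-z.im)

end Powers

/-! ### Synthesis operators of finite families -/

section Synthesis

variable {ι : Type*} [Fintype ι] {E F : Type*}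
  [NormedAddCommGroup E] [InnerProductSpace ℂ E]
  [NormedAddCommGroup F] [InnerProductSpace ℂ F]

/-- The synthesis operator `c ↦ ∑ i, c i • x i` of a finite family of vectors. -/
def synthesis (x : ι → E) : EuclideanSpace ℂ ι →L[ℂ] E :=
  ∑ i, (EuclideanSpace.proj i : EuclideanSpace ℂ ι →L[ℂ] ℂ).smulRight (x i)

theorem synthesis_apply (x : ι → E) (c : EuclideanSpace ℂ ι) :
    synthesis x c = ∑ i, c i • x i := by
  simp [synthesis, sum_apply]

theorem synthesis_single [DecidableEq ι] (x : ι → E) (i : ι) :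
    synthesis x (EuclideanSpace.single i 1) = x i := by
  rw [synthesis_apply, Finset.sum_eq_single i] <;> simp +contextual

theorem continuous_synthesis : Continuous (synthesis : (ι → E) → _) := by
  unfold synthesis
  refine continuous_finsetSum _ fun i _ => ?_
  exact ((ContinuousLinearMap.smulRightL ℂ (EuclideanSpace ℂ ι) E
    (EuclideanSpace.proj i)).continuous).comp (continuous_apply i)

theorem synthesis_comp (V : E →L[ℂ] F) (x : ι → E) :
    synthesis (fun i => V (x i)) = V ∘L synthesis x := by
  ext c
  simp [synthesis_apply]

/-- Unlike orthonormality, a bound on the synthesis norm is stable under bounded operators; this is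
why test families are measured by it. -/
theorem norm_synthesis_comp_le (V : E →L[ℂ] F) (x : ι → E) :
    ‖synthesis (fun i => V (x i))‖ ≤ ‖V‖ * ‖synthesis x‖ := by
  rw [synthesis_comp]
  exact V.opNorm_comp_le _

theorem norm_synthesis_le_one {x : ι → E} (hx : Orthonormal ℂ x) : ‖synthesis x‖ ≤ 1 := by
  refine ContinuousLinearMap.opNorm_le_bound _ zero_le_one fun c => ?_
  rw [one_mul, synthesis_apply, ← sq_le_sq₀ (norm_nonneg _) (norm_nonneg _),
    EuclideanSpace.norm_sq_eq, @norm_sq_eq_re_inner ℂ, hx.inner_sum]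
  simp [Complex.conj_mul', ← Complex.ofReal_pow]

theorem orthonormal_fin_cons {n : ℕ} {x : Fin n → E} (hx : Orthonormal ℂ x) {e : E}
    (he : ‖e‖ = 1) (hex : ∀ i, inner ℂ (x i) e = 0) :
    Orthonormal ℂ (Fin.cons e x : Fin (n + 1) → E) := by
  refine ⟨fun i => ?_, fun i j hij => ?_⟩
  · refine Fin.cases ?_ (fun i => ?_) i
    · simpa using he
    · simpa using hx.1 i
  · induction i using Fin.cases with
    | zero =>
      induction j using Fin.cases with
      | zero => exact absurd rfl hij
      | succ j => simpa using inner_eq_zero_symm.1 (hex j)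
    | succ i =>
      induction j using Fin.cases with
      | zero => simpa using hex i
      | succ j => simpa using hx.2 (fun h => hij (by rw [h]))

variable [CompleteSpace E]

/-- Bessel's inequality without orthonormality: the inner products are the coordinates of the
adjoint synthesis operator applied to `u`. -/
theorem sum_norm_inner_sq_le (x : ι → E) (u : E) :
    ∑ i, ‖inner ℂ (x i) u‖ ^ 2 ≤ (‖synthesis x‖ * ‖u‖) ^ 2 := by
  classical
  have h : ∀ i, inner ℂ (x i) u = (synthesis x).adjoint u i := by
    intro i
    conv_lhs => rw [← synthesis_single x i]
    rw [← ContinuousLinearMap.adjoint_inner_right, EuclideanSpace.inner_single_left]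
    simp
  simp_rw [h]
  rw [← EuclideanSpace.norm_sq_eq]
  gcongr
  rw [← LinearIsometryEquiv.norm_map ContinuousLinearMap.adjoint (synthesis x)]
  exact ContinuousLinearMap.le_opNorm _ _

end Synthesis

/-! ### Schatten classes -/

theorem isCompactOperator_starProjection {E : Type*} [NormedAddCommGroup E]
    [InnerProductSpace ℂ E] (K : Submodule ℂ E) [FiniteDimensional ℂ K] :
    IsCompactOperator K.starProjection := by
  have : ProperSpace K := FiniteDimensional.proper ℂ K
  have h : IsCompactOperator K.orthogonalProjectionOnto :=
    isCompactOperator_of_locallyCompactSpace_dom _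
  exact h.clm_comp K.subtypeL

theorem sum_mul_le_of_sum_sq_le {ι : Type*} [Fintype ι] {X Y : ℝ} (hX : 0 ≤ X) (hY : 0 ≤ Y)
    (f g : ι → ℝ) (hf : ∑ j, f j ^ 2 ≤ Y ^ 2) (hg : ∑ j, g j ^ 2 ≤ X ^ 2) :
    ∑ j, f j * g j ≤ X * Y := by
  refine (Real.sum_mul_le_sqrt_mul_sqrt Finset.univ f g).trans ?_
  rw [mul_comm]
  exact mul_le_mul (Real.sqrt_le_iff.2 ⟨hX, hg⟩) (Real.sqrt_le_iff.2 ⟨hY, hf⟩)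
    (Real.sqrt_nonneg _) hX

theorem norm_le_norm_synthesis {ι E : Type*} [Fintype ι] [NormedAddCommGroup E]
    [InnerProductSpace ℂ E] (x : ι → E) (i : ι) : ‖x i‖ ≤ ‖synthesis x‖ := by
  classical
  conv_lhs => rw [← synthesis_single x i]
  simpa using (synthesis x).le_opNorm (EuclideanSpace.single i 1)

/-- Schur's test. Hölder's inequality with weights `a i n` costs `K ^ (p - 1)` per row, and summing
over columns costs one more factor `K`. -/
theorem sum_rpow_sum_le {ι κ : Type*} [Fintype ι] [Fintype κ] {p : ℝ} (hp : 1 ≤ p) {K : ℝ}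
    (hK : 0 ≤ K) (a : ι → κ → ℝ) (ha : ∀ i n, 0 ≤ a i n) (hrow : ∀ i, ∑ n, a i n ≤ K)
    (hcol : ∀ n, ∑ i, a i n ≤ K) (s : κ → ℝ) (hs : ∀ n, 0 ≤ s n) :
    ∑ i, (∑ n, a i n * s n) ^ p ≤ K ^ p * ∑ n, s n ^ p := by
  have hp0 : 0 < p := by linarith
  have h1 : ∀ i, (∑ n, a i n * s n) ^ p ≤ K ^ (p - 1) * ∑ n, a i n * s n ^ p := by
    intro i
    have hA : 0 ≤ ∑ n, a i n := Finset.sum_nonneg fun n _ => ha i n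
    have hB : 0 ≤ ∑ n, a i n * s n ^ p :=
      Finset.sum_nonneg fun n _ => mul_nonneg (ha i n) (Real.rpow_nonneg (hs n) _)
    have h2 := Real.inner_le_weight_mul_Lp_of_nonneg Finset.univ hp (a i) s (ha i) hs
    have h3 := Real.rpow_le_rpow (Finset.sum_nonneg fun n _ => mul_nonneg (ha i n) (hs n)) h2 hp0.le
    rw [Real.mul_rpow (Real.rpow_nonneg hA _) (Real.rpow_nonneg hB _), ← Real.rpow_mul hA,
      ← Real.rpow_mul hB, inv_mul_cancel₀ hp0.ne', Real.rpow_one, sub_mul, one_mul,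
      inv_mul_cancel₀ hp0.ne'] at h3
    refine h3.trans ?_
    gcongr
    exact hrow i
  calc ∑ i, (∑ n, a i n * s n) ^ p ≤ ∑ i, K ^ (p - 1) * ∑ n, a i n * s n ^ p :=
        Finset.sum_le_sum fun i _ => h1 i
    _ = K ^ (p - 1) * ∑ n, (∑ i, a i n) * s n ^ p := by
        rw [← Finset.mul_sum, Finset.sum_comm]
        simp_rw [Finset.sum_mul]
    _ ≤ K ^ (p - 1) * ∑ n, K * s n ^ p := by
        gcongr with n
        · exact Real.rpow_nonneg (hs n) _
        · exact hcol n
    _ = K ^ p * ∑ n, s n ^ p := by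
        rw [← Finset.mul_sum, ← mul_assoc]
        congr 1
        rw [← Real.rpow_add_one' hK (by linarith), sub_add_cancel]

/-- For fixed `ε`, orthonormal systems with all `‖⟪y i, B (x i)⟫‖ ≥ ε` have bounded length. When
such a pair cannot be lengthened, `B` compressed to the orthogonal complements has norm at most `ε`,
and the remainder factors through finite-dimensional projections. Hence `B` is a norm limit of
compact operators. -/
theorem isCompactOperator_of_sum_norm_inner_rpow_le {E F : Type*} [NormedAddCommGroup E]
    [InnerProductSpace ℂ E] [NormedAddCommGroup F] [InnerProductSpace ℂ F] [CompleteSpace F]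
    {p M : ℝ} (hp : 0 < p) (B : E →L[ℂ] F)
    (hB : ∀ (n : ℕ) (x : Fin n → E) (y : Fin n → F), Orthonormal ℂ x → Orthonormal ℂ y →
      ∑ i, ‖inner ℂ (y i) (B (x i))‖ ^ p ≤ M) : IsCompactOperator B := by
  have hcl : IsClosed {f : E →L[ℂ] F | IsCompactOperator f} := isClosed_setOfPred_isCompactOperator
  refine hcl.closure_subset (Metric.mem_closure_iff.2 fun ε' hε' => ?_)
  obtain ⟨ε, hε, hεε'⟩ := exists_between hε'
  let P : ℕ → Prop := fun n => ∃ (x : Fin n → E) (y : Fin n → F), Orthonormal ℂ x ∧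
    Orthonormal ℂ y ∧ ∀ i, ε ≤ ‖inner ℂ (y i) (B (x i))‖
  obtain ⟨n, ⟨x, y, hx, hy, hxy⟩, hn⟩ : ∃ n, P n ∧ ¬ P (n + 1) := by
    by_contra! hcon
    have hall : ∀ n, P n := fun n => by
      induction n with
      | zero => exact ⟨Fin.elim0, Fin.elim0, ⟨fun i => i.elim0, fun i => i.elim0⟩,
          ⟨fun i => i.elim0, fun i => i.elim0⟩, fun i => i.elim0⟩
      | succ n ih => exact hcon n ih
    obtain ⟨n, hn⟩ := exists_nat_gt (M / ε ^ p)
    obtain ⟨x, y, hx, hy, hxy⟩ := hall n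
    have h1 : ∑ _i : Fin n, ε ^ p ≤ M :=
      (Finset.sum_le_sum fun i _ => Real.rpow_le_rpow hε.le (hxy i) hp.le).trans (hB n x y hx hy)
    rw [Finset.sum_const, Finset.card_univ, Fintype.card_fin, nsmul_eq_mul] at h1
    rw [div_lt_iff₀ (by positivity)] at hn
    linarith
  set U : Submodule ℂ E := Submodule.span ℂ (Set.range x)
  set W : Submodule ℂ F := Submodule.span ℂ (Set.range y)
  -- A violating pair, normalized, could be prepended to `x` and `y`, contradicting `hn`.
  have hUW : ∀ e ∈ Uᗮ, ∀ f ∈ Wᗮ, ‖inner ℂ f (B e)‖ ≤ ε * ‖f‖ * ‖e‖ := by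
    intro e he f hf
    by_contra! hlt
    have he0 : e ≠ 0 := by rintro rfl; simp at hlt
    have hf0 : f ≠ 0 := by rintro rfl; simp at hlt
    have hen : 0 < ‖e‖ := norm_pos_iff.2 he0
    have hfn : 0 < ‖f‖ := norm_pos_iff.2 hf0
    refine hn ⟨Fin.cons (((‖e‖ : ℂ)⁻¹) • e) x, Fin.cons (((‖f‖ : ℂ)⁻¹) • f) y,
      orthonormal_fin_cons hx ?_ fun i => ?_, orthonormal_fin_cons hy ?_ fun i => ?_, fun i => ?_⟩
    · simp [norm_smul, hen.ne']
    · rw [inner_smul_right, he (x i) (Submodule.subset_span ⟨i, rfl⟩), mul_zero]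
    · simp [norm_smul, hfn.ne']
    · rw [inner_smul_right, hf (y i) (Submodule.subset_span ⟨i, rfl⟩), mul_zero]
    · refine Fin.cases ?_ (fun i => ?_) i
      · simp only [Fin.cons_zero, map_smul, inner_smul_left, inner_smul_right, norm_mul, norm_inv,
          map_inv₀, Complex.conj_ofReal, Complex.norm_real, norm_norm]
        rw [← mul_assoc, ← mul_inv, inv_mul_eq_div, le_div_iff₀ (by positivity)]
        linarith
      · simpa using hxy i
  have : FiniteDimensional ℂ U := FiniteDimensional.span_of_finite ℂ (Set.finite_range x)
  have : FiniteDimensional ℂ W := FiniteDimensional.span_of_finite ℂ (Set.finite_range y)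
  set D : E →L[ℂ] F := Wᗮ.starProjection ∘L B ∘L Uᗮ.starProjection with hD
  refine ⟨B - D, ?_, ?_⟩
  · have h1 : B - D = W.starProjection ∘L B
        + Wᗮ.starProjection ∘L B ∘L U.starProjection := by
      ext e
      simp only [hD, sub_apply, add_apply, ContinuousLinearMap.comp_apply,
        Submodule.starProjection_orthogonal_val, map_sub]
      abel
    show IsCompactOperator (B - D)
    rw [h1]
    refine IsCompactOperator.add ?_ ?_
    · exact (isCompactOperator_starProjection W).comp_clm B
    · exact ((isCompactOperator_starProjection U).clm_comp B).clm_comp Wᗮ.starProjection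
  · rw [dist_eq_norm, sub_sub_cancel]
    refine lt_of_le_of_lt (ContinuousLinearMap.opNorm_le_bound _ hε.le fun e => ?_) hεε'
    have h2 : D e ∈ Wᗮ := Submodule.starProjection_apply_mem _ _
    have h3 : inner ℂ (D e) (D e) = inner ℂ (D e) (B (Uᗮ.starProjection e)) := by
      conv_rhs => rw [← Submodule.starProjection_eq_self_iff.2 h2]
      rw [Submodule.inner_starProjection_left_eq_right]
      rfl
    have h5 : ‖D e‖ ^ 2 ≤ ε * ‖D e‖ * ‖e‖ := by
      have h6 := hUW _ (Submodule.starProjection_apply_mem Uᗮ e) _ h2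
      rw [← h3, inner_self_eq_norm_sq_to_K] at h6
      have h7 : ‖Uᗮ.starProjection e‖ ≤ ‖e‖ := Submodule.norm_starProjection_apply_le _ _
      calc ‖D e‖ ^ 2 ≤ ε * ‖D e‖ * ‖Uᗮ.starProjection e‖ := by simpa using h6
        _ ≤ _ := by gcongr
    rcases (norm_nonneg (D e)).eq_or_lt with h8 | h8
    · rw [← h8]; positivity
    · refine le_of_mul_le_mul_left ?_ h8
      calc ‖D e‖ * ‖D e‖ = ‖D e‖ ^ 2 := by ring
        _ ≤ _ := h5
        _ = _ := by ring

/-! ### Singular systems and the description of Schatten classes by test families -/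

section Schatten

variable {E F : Type*}
  [NormedAddCommGroup E] [InnerProductSpace ℂ E] [CompleteSpace E]
  [NormedAddCommGroup F] [InnerProductSpace ℂ F] [CompleteSpace F]

/-- The expansion bounds `‖⟪y i, A (x i)⟫‖` by `∑ n, b i n * c i n * s n`. Bessel's inequality, used
in both directions, and Cauchy–Schwarz bound all row and column sums of `b i n * c i n` by `X * Y`,
so Schur's test applies. -/
theorem sum_norm_inner_rpow_le_of_singular_expansion {ι κ : Type*} [Fintype ι] [Fintype κ] {p : ℝ}
    (hp : 1 ≤ p) {A : E →L[ℂ] F} {u : κ → E} {v : κ → F} (hu : Orthonormal ℂ u)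
    (hv : Orthonormal ℂ v) {s : κ → ℝ} (hs : ∀ n, 0 ≤ s n) {x : ι → E}
    (hA : ∀ i, A (x i) = ∑ n, ((s n : ℂ) * inner ℂ (u n) (x i)) • v n) (y : ι → F) :
    ∑ i, ‖inner ℂ (y i) (A (x i))‖ ^ p
      ≤ (‖synthesis x‖ * ‖synthesis y‖) ^ p * ∑ n, s n ^ p := by
  classical
  set X := ‖synthesis x‖
  set Y := ‖synthesis y‖
  have hX : 0 ≤ X := norm_nonneg _
  have hY : 0 ≤ Y := norm_nonneg _
  set b : ι → κ → ℝ := fun i n => ‖inner ℂ (y i) (v n)‖ with hb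
  set c : ι → κ → ℝ := fun i n => ‖inner ℂ (u n) (x i)‖ with hc
  have hbi : ∀ i, ∑ n, b i n ^ 2 ≤ Y ^ 2 := fun i => by
    simp_rw [hb, norm_inner_symm (y i)]
    exact (hv.sum_inner_products_le _).trans (by gcongr; exact norm_le_norm_synthesis y i)
  have hci : ∀ i, ∑ n, c i n ^ 2 ≤ X ^ 2 := fun i =>
    (hu.sum_inner_products_le _).trans (by gcongr; exact norm_le_norm_synthesis x i)
  have hbn : ∀ n, ∑ i, b i n ^ 2 ≤ Y ^ 2 := fun n =>
    (sum_norm_inner_sq_le y (v n)).trans_eq (by rw [hv.1 n, mul_one])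
  have hcn : ∀ n, ∑ i, c i n ^ 2 ≤ X ^ 2 := fun n => by
    simp_rw [hc, norm_inner_symm (u n)]
    exact (sum_norm_inner_sq_le x (u n)).trans_eq (by rw [hu.1 n, mul_one])
  refine le_trans ?_ (sum_rpow_sum_le hp (mul_nonneg hX hY) (fun i n => b i n * c i n)
    (fun i n => by positivity) (fun i => sum_mul_le_of_sum_sq_le hX hY _ _ (hbi i) (hci i))
    (fun n => sum_mul_le_of_sum_sq_le hX hY (fun i => b i n) (fun i => c i n) (hbn n) (hcn n)) s hs)
  refine Finset.sum_le_sum fun i _ => ?_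
  refine Real.rpow_le_rpow (norm_nonneg _) ?_ (by linarith)
  rw [hA i, inner_sum]
  refine (norm_sum_le _ _).trans (Finset.sum_le_sum fun n _ => le_of_eq ?_)
  rw [inner_smul_right, norm_mul, norm_mul, Complex.norm_real, Real.norm_of_nonneg (hs n)]
  simp only [hb, hc]
  ring

theorem isSymmetric_adjoint_comp_self (A : E →L[ℂ] F) :
    ((A.adjoint ∘L A : E →L[ℂ] E) : E →ₗ[ℂ] E).IsSymmetric := fun x y => by
  simp [ContinuousLinearMap.adjoint_inner_left, ContinuousLinearMap.adjoint_inner_right]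

/-- The eigenspace of `A* A` for the eigenvalue `t²`. -/
abbrev singularSpace (A : E →L[ℂ] F) (t : ℝ) : Submodule ℂ E :=
  Module.End.eigenspace
    ((ContinuousLinearMap.adjoint A ∘L A : E →L[ℂ] E) : E →ₗ[ℂ] E) ((t ^ 2 : ℝ) : ℂ)

theorem adjoint_apply_of_mem_singularSpace {A : E →L[ℂ] F} {t : ℝ} {x : E}
    (hx : x ∈ singularSpace A t) : A.adjoint (A x) = ((t ^ 2 : ℝ) : ℂ) • x :=
  Module.End.mem_eigenspace_iff.1 hx

/-- An orthonormal system of right singular vectors exhausting finitely many singular spaces. -/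
theorem exists_singular_system {A : E →L[ℂ] F} (hA : IsCompactOperator A)
    (τ : Finset (Set.Ioi (0 : ℝ))) :
    ∃ u : (Σ t : τ, Fin (singularMultiplicity A t)) → E, Orthonormal ℂ u ∧
      (∀ n, u n ∈ singularSpace A n.1) ∧
      ∀ t ∈ τ, ∀ x ∈ singularSpace A t, ∑ n, inner ℂ (u n) x • u n = x := by
  classical
  have hsymm := isSymmetric_adjoint_comp_self A
  have hcomp : IsCompactOperator (A.adjoint ∘L A : E →L[ℂ] E) :=
    hA.clm_comp A.adjoint
  have hinj : Function.Injective (fun t : τ => (((t : ℝ) ^ 2 : ℝ) : ℂ)) := by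
    intro s t h
    have h1 : ((s : ℝ)) ^ 2 = (t : ℝ) ^ 2 := Complex.ofReal_injective h
    have hs : (0 : ℝ) < (s : Set.Ioi (0 : ℝ)) := (s : Set.Ioi (0 : ℝ)).2
    have ht : (0 : ℝ) < (t : Set.Ioi (0 : ℝ)) := (t : Set.Ioi (0 : ℝ)).2
    exact Subtype.ext (Subtype.ext ((sq_eq_sq₀ hs.le ht.le).1 h1))
  have hfam : OrthogonalFamily ℂ (fun t : τ => singularSpace A t)
      fun t => (singularSpace A t).subtypeₗᵢ := hsymm.orthogonalFamily_eigenspaces.comp hinj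
  have hfin : ∀ t : τ, FiniteDimensional ℂ (singularSpace A t) := fun t =>
    ContinuousLinearMap.finite_dimensional_eigenspace hcomp _ (by
      have ht : (0 : ℝ) < (t : Set.Ioi (0 : ℝ)) := (t : Set.Ioi (0 : ℝ)).2
      exact_mod_cast (pow_pos ht 2).ne')
  let b : ∀ t : τ, OrthonormalBasis (Fin (singularMultiplicity A t)) ℂ (singularSpace A t) :=
    fun t => stdOrthonormalBasis ℂ (singularSpace A t)
  refine ⟨fun n => (b n.1 n.2 : E),
    hfam.orthonormal_sigma_orthonormal (v_family := fun t j => b t j) fun t => (b t).orthonormal,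
    fun n => (b n.1 n.2).2, fun t ht x hx => ?_⟩
  rw [Fintype.sum_sigma, Finset.sum_eq_single ⟨t, ht⟩]
  · have := (b ⟨t, ht⟩).sum_repr ⟨x, hx⟩
    have h2 := congrArg (Submodule.subtype _) this
    rw [map_sum] at h2
    simpa [OrthonormalBasis.repr_apply_apply] using h2
  · intro s _ hs
    refine Finset.sum_eq_zero fun j _ => ?_
    have := hfam hs (b s j) (⟨x, hx⟩ : singularSpace A (⟨t, ht⟩ : τ))
    have h3 : inner ℂ (b s j : E) x = 0 := this
    rw [h3, zero_smul]
  · simp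

theorem orthonormal_left_singular {A : E →L[ℂ] F} {κ : Type*} {u : κ → E} (hu : Orthonormal ℂ u)
    {s : κ → ℝ} (hs : ∀ n, 0 < s n) (hus : ∀ n, u n ∈ singularSpace A (s n)) :
    Orthonormal ℂ (fun n => ((s n : ℂ)⁻¹) • A (u n)) := by
  classical
  rw [orthonormal_iff_ite] at hu ⊢
  intro i j
  rw [inner_smul_left, inner_smul_right, ← ContinuousLinearMap.adjoint_inner_right,
    adjoint_apply_of_mem_singularSpace (hus j), inner_smul_right, hu i j]
  have hj : (s j : ℂ) ≠ 0 := by exact_mod_cast (hs j).ne'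
  split_ifs with h
  · subst h
    simp only [map_inv₀, Complex.conj_ofReal]
    push_cast
    field_simp
  · simp

/-- Vectors in the algebraic span of the eigenspaces of `A* A` involve finitely many eigenvalues, so
the expansion is a finite sum and no convergence question arises. -/
theorem exists_singular_expansion {ι : Type*} [Fintype ι] {A : E →L[ℂ] F}
    (hA : IsCompactOperator A) {x : ι → E}
    (hx : ∀ i, x i ∈ ⨆ μ, Module.End.eigenspace
      ((ContinuousLinearMap.adjoint A ∘L A : E →L[ℂ] E) : E →ₗ[ℂ] E) μ) :
    ∃ (τ : Finset (Set.Ioi (0 : ℝ))) (u : (Σ t : τ, Fin (singularMultiplicity A t)) → E),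
      Orthonormal ℂ u ∧ (∀ n, u n ∈ singularSpace A n.1) ∧
      ∀ i, A (x i) = ∑ n, inner ℂ (u n) (x i) • A (u n) := by
  classical
  have hsymm := isSymmetric_adjoint_comp_self A
  choose M hM using fun i => Submodule.mem_iSup_iff_exists_finset.1 (hx i)
  -- Each eigenvalue carried by a nonzero vector is `t²` with `t ≥ 0`; passing to the subtype
  -- discards `t = 0`.
  set τ : Finset (Set.Ioi (0 : ℝ)) :=
    ((Finset.univ.biUnion M).image fun μ => Real.sqrt μ.re).subtype (· ∈ Set.Ioi (0 : ℝ)) with hτ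
  obtain ⟨u, hu, hus, hsum⟩ := exists_singular_system hA τ
  refine ⟨τ, u, hu, hus, fun i => ?_⟩
  -- The defect of the expansion is linear, so it suffices that it vanish on eigenvectors.
  set L : E →ₗ[ℂ] F := (A : E →ₗ[ℂ] F) -
    ∑ n, (innerSL ℂ (u n) : E →ₗ[ℂ] ℂ).smulRight (A (u n)) with hL
  have hLapp : ∀ w, L w = A w - ∑ n, inner ℂ (u n) w • A (u n) := fun w => by
    simp [hL, LinearMap.sum_apply]
  suffices h : x i ∈ LinearMap.ker L by
    rw [LinearMap.mem_ker, hLapp, sub_eq_zero] at h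
    exact h
  refine (iSup₂_le fun μ hμ w hw => ?_ : (⨆ μ ∈ M i, _) ≤ LinearMap.ker L) (hM i)
  rw [LinearMap.mem_ker, hLapp, sub_eq_zero]
  have hw' : A.adjoint (A w) = μ • w := Module.End.mem_eigenspace_iff.1 hw
  by_cases hw0 : w = 0
  · simp [hw0]
  have hAw : ((‖A w‖ ^ 2 : ℝ) : ℂ) = μ * ((‖w‖ ^ 2 : ℝ) : ℂ) := by
    have h1 : inner ℂ w (A.adjoint (A w)) = inner ℂ (A w) (A w) :=
      ContinuousLinearMap.adjoint_inner_right _ _ _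
    rw [hw', inner_smul_right, inner_self_eq_norm_sq_to_K, inner_self_eq_norm_sq_to_K] at h1
    push_cast
    exact h1.symm
  have hwn : 0 < ‖w‖ := norm_pos_iff.2 hw0
  set t : ℝ := ‖A w‖ / ‖w‖ with ht
  have hμt : μ = ((t ^ 2 : ℝ) : ℂ) := by
    have h2 : ((‖w‖ ^ 2 : ℝ) : ℂ) ≠ 0 := by exact_mod_cast (pow_pos hwn 2).ne'
    rw [ht, div_pow, Complex.ofReal_div, hAw, mul_div_cancel_right₀ _ h2]
  have ht0 : 0 ≤ t := by positivity
  -- For `t = 0` the vector lies in `ker A`, which is orthogonal to every `u n`; for `t > 0` it is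
  -- reproduced by the system `u`.
  rcases ht0.eq_or_lt with h0 | hpos
  · have hAw0 : A w = 0 := by
      have : ‖A w‖ = t * ‖w‖ := by rw [ht]; field_simp
      rw [← norm_eq_zero, this, ← h0, zero_mul]
    rw [hAw0]
    symm
    refine Finset.sum_eq_zero fun n _ => ?_
    have hn : (0 : ℝ) < (n.1 : Set.Ioi (0 : ℝ)) := (n.1 : Set.Ioi (0 : ℝ)).2
    have h3 : inner ℂ (u n) w = 0 := by
      have h4 := ContinuousLinearMap.adjoint_inner_left A w (A (u n))
      rw [adjoint_apply_of_mem_singularSpace (hus n), hAw0, inner_zero_right,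
        inner_smul_left] at h4
      refine (mul_eq_zero.1 h4).resolve_left ?_
      rw [Complex.conj_ofReal]
      exact_mod_cast (pow_pos hn 2).ne'
    rw [h3, zero_smul]
  · have htτ : (⟨t, hpos⟩ : Set.Ioi (0 : ℝ)) ∈ τ := by
      rw [hτ, Finset.mem_subtype, Finset.mem_image]
      refine ⟨μ, Finset.mem_biUnion.2 ⟨i, Finset.mem_univ _, hμ⟩, ?_⟩
      rw [hμt, Complex.ofReal_re, Real.sqrt_sq ht0]
    have h5 := congrArg A (hsum ⟨t, hpos⟩ htτ w (by rw [hμt] at hw; exact hw))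
    rw [map_sum] at h5
    simp_rw [map_smul] at h5
    exact h5.symm

theorem sum_sigma_singularMultiplicity (A : E →L[ℂ] F) (p : ℝ) (τ : Finset (Set.Ioi (0 : ℝ))) :
    ∑ n : (Σ t : τ, Fin (singularMultiplicity A t)), ((n.1 : Set.Ioi (0 : ℝ)) : ℝ) ^ p
      = ∑ t ∈ τ, (singularMultiplicity A t : ℝ) * (t : ℝ) ^ p := by
  rw [Fintype.sum_sigma,
    ← Finset.sum_coe_sort τ fun t => (singularMultiplicity A t : ℝ) * (t : ℝ) ^ p]
  simp

theorem schattenNorm_nonneg (p : ℝ) (A : E →L[ℂ] F) : 0 ≤ schattenNorm p A :=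
  Real.rpow_nonneg (tsum_nonneg fun t => mul_nonneg (Nat.cast_nonneg _)
    (Real.rpow_nonneg (le_of_lt t.2) _)) _

theorem schattenNorm_rpow {p : ℝ} (hp : p ≠ 0) (A : E →L[ℂ] F) :
    schattenNorm p A ^ p = ∑' t : Set.Ioi (0 : ℝ), (singularMultiplicity A t : ℝ) * (t : ℝ) ^ p := by
  rw [schattenNorm, ← Real.rpow_mul (tsum_nonneg fun t => mul_nonneg (Nat.cast_nonneg _)
    (Real.rpow_nonneg (le_of_lt t.2) _)), one_div, inv_mul_cancel₀ hp, Real.rpow_one]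

/-- By the spectral theorem for the compact operator `A* A`, finite sums of its eigenvectors are
dense. Both sides are continuous in `x`, so the finite expansion settles the general case. -/
theorem MemSchatten.sum_norm_inner_rpow_le {ι : Type*} [Fintype ι] {p : ℝ} (hp : 1 ≤ p)
    {A : E →L[ℂ] F} (hA : MemSchatten p A) (x : ι → E) (y : ι → F) :
    ∑ i, ‖inner ℂ (y i) (A (x i))‖ ^ p
      ≤ (‖synthesis x‖ * ‖synthesis y‖ * schattenNorm p A) ^ p := by
  have hp0 : 0 < p := by linarith
  set D : Submodule ℂ E := ⨆ μ, Module.End.eigenspace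
      ((ContinuousLinearMap.adjoint A ∘L A : E →L[ℂ] E) : E →ₗ[ℂ] E) μ with hD
  have hdense : Dense (D : Set E) := by
    rw [Submodule.dense_iff_topologicalClosure_eq_top, Submodule.topologicalClosure_eq_top_iff]
    exact ContinuousLinearMap.orthogonalComplement_iSup_eigenspaces_eq_bot
      (hA.1.clm_comp A.adjoint) (isSymmetric_adjoint_comp_self A)
  have hdense' : Dense {x : ι → E | ∀ i, x i ∈ D} := by
    have := dense_pi (Set.univ : Set ι) (s := fun _ => (D : Set E)) fun i _ => hdense
    convert this using 1
    ext x; simp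
  have hclosed : IsClosed {x : ι → E | ∑ i, ‖inner ℂ (y i) (A (x i))‖ ^ p
      ≤ (‖synthesis x‖ * ‖synthesis y‖ * schattenNorm p A) ^ p} := by
    have := continuous_synthesis (ι := ι) (E := E)
    refine isClosed_le ?_ ?_
    · refine continuous_finsetSum _ fun i _ => Continuous.rpow_const (by fun_prop) fun _ => Or.inr hp0.le
    · exact Continuous.rpow_const (by fun_prop) fun _ => Or.inr hp0.le
  refine hclosed.closure_subset_iff.2 (fun x hx => ?_) (hdense' x)
  obtain ⟨τ, u, hu, hus, hexp⟩ := exists_singular_expansion hA.1 hx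
  set s : (Σ t : τ, Fin (singularMultiplicity A t)) → ℝ :=
    fun n => ((n.1 : Set.Ioi (0 : ℝ)) : ℝ) with hs
  have hspos : ∀ n, 0 < s n := fun n => (n.1 : Set.Ioi (0 : ℝ)).2
  have h1 := sum_norm_inner_rpow_le_of_singular_expansion hp hu
    (orthonormal_left_singular hu hspos hus) (fun n => (hspos n).le) (A := A) (x := x) (fun i => by
      rw [hexp i]
      refine Finset.sum_congr rfl fun n _ => ?_
      have : (s n : ℂ) ≠ 0 := by exact_mod_cast (hspos n).ne'
      rw [smul_smul]
      congr 1
      field_simp) y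
  refine h1.trans ?_
  rw [Real.mul_rpow (by positivity) (schattenNorm_nonneg p A), schattenNorm_rpow hp0.ne',
    sum_sigma_singularMultiplicity]
  gcongr
  exact hA.2.sum_le_tsum τ fun t _ => mul_nonneg (Nat.cast_nonneg _)
    (Real.rpow_nonneg (le_of_lt t.2) _)

/-- Once `B` is compact, testing on right and left singular vectors makes each inner product a
singular value, so the hypothesis bounds every partial sum. -/
theorem memSchatten_of_sum_norm_inner_rpow_le {p M : ℝ} (hp : 1 ≤ p) (hM : 0 ≤ M) (B : E →L[ℂ] F)
    (hB : ∀ (n : ℕ) (x : Fin n → E) (y : Fin n → F), Orthonormal ℂ x → Orthonormal ℂ y →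
      ∑ i, ‖inner ℂ (y i) (B (x i))‖ ^ p ≤ M ^ p) :
    MemSchatten p B ∧ schattenNorm p B ≤ M := by
  have hp0 : 0 < p := by linarith
  have hcomp := isCompactOperator_of_sum_norm_inner_rpow_le hp0 B hB
  have hnonneg : ∀ t : Set.Ioi (0 : ℝ), 0 ≤ (singularMultiplicity B t : ℝ) * (t : ℝ) ^ p :=
    fun t => mul_nonneg (Nat.cast_nonneg _) (Real.rpow_nonneg (le_of_lt t.2) _)
  have hfin : ∀ τ : Finset (Set.Ioi (0 : ℝ)),
      ∑ t ∈ τ, (singularMultiplicity B t : ℝ) * (t : ℝ) ^ p ≤ M ^ p := by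
    intro τ
    obtain ⟨u, hu, hus, -⟩ := exists_singular_system hcomp τ
    rw [← sum_sigma_singularMultiplicity]
    have hspos : ∀ n : (Σ t : τ, Fin (singularMultiplicity B t)),
      (0 : ℝ) < ((n.1 : Set.Ioi (0 : ℝ)) : ℝ) := fun n => (n.1 : Set.Ioi (0 : ℝ)).2
    have hv := orthonormal_left_singular hu hspos hus
    let e := (Fintype.equivFin (Σ t : τ, Fin (singularMultiplicity B t))).symm
    have h1 := hB _ (u ∘ e) _ (hu.comp e e.injective) (hv.comp e e.injective)
    rw [← e.sum_comp]
    refine le_trans (le_of_eq (Finset.sum_congr rfl fun i _ => ?_)) h1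
    congr 1
    have hpos := hspos (e i)
    have hne : ((((e i).1 : Set.Ioi (0 : ℝ)) : ℝ) : ℂ) ≠ 0 := by exact_mod_cast hpos.ne'
    simp only [Function.comp_apply, inner_smul_left]
    rw [← ContinuousLinearMap.adjoint_inner_right, adjoint_apply_of_mem_singularSpace (hus (e i)),
      inner_smul_right, inner_self_eq_norm_sq_to_K, hu.1]
    simp only [map_inv₀, Complex.conj_ofReal]
    have : ((((e i).1 : Set.Ioi (0 : ℝ)) : ℝ) : ℂ)⁻¹ * (((((e i).1 : Set.Ioi (0 : ℝ)) : ℝ) ^ 2 : ℝ) *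
        ((1 : ℝ) : ℂ) ^ 2) = ((((e i).1 : Set.Ioi (0 : ℝ)) : ℝ) : ℂ) := by
      push_cast; field_simp
    erw [this]
    rw [Complex.norm_real, Real.norm_of_nonneg hpos.le]
  have hsum := summable_of_sum_le hnonneg hfin
  refine ⟨⟨hcomp, hsum⟩, ?_⟩
  rw [schattenNorm]
  calc _ ≤ (M ^ p) ^ (1 / p) :=
        Real.rpow_le_rpow (tsum_nonneg hnonneg) (hsum.tsum_le_of_sum_le hfin) (by positivity)
    _ = M := by rw [← Real.rpow_mul hM, mul_one_div_cancel hp0.ne', Real.rpow_one]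

end Schatten

/-! ### Interpolation in the strip -/

theorem mul_sub_mul_sq_le {k : ℝ} (hk : 0 < k) (c y : ℝ) :
    c * |y| - k * y ^ 2 ≤ (4 * k)⁻¹ * c ^ 2 := by
  have h : (4 * k)⁻¹ * c ^ 2 - (c * |y| - k * y ^ 2) = (4 * k)⁻¹ * (c - 2 * k * |y|) ^ 2 := by
    rw [← sq_abs y]; field_simp; ring
  have : 0 ≤ (4 * k)⁻¹ * (c - 2 * k * |y|) ^ 2 := by positivity
  linarith

/-- The polynomial `z² - z` gives Gaussian decay in `Im z`, while its dependence on `Re z` vanishes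
on both edges. -/
theorem norm_exp_mul_sq_sub (k : ℝ) (z : ℂ) :
    ‖Complex.exp (k * (z ^ 2 - z))‖ = Real.exp (-(k * z.im ^ 2 + k * z.re * (1 - z.re))) := by
  rw [Complex.norm_exp]
  congr 1
  simp [pow_two]
  ring

/-- The three lines theorem for `ℓ^p`-valued functions of exponential growth. -/
theorem sum_norm_rpow_le_of_three_lines {ι : Type*} [Fintype ι] {p : ℝ} (hp : 1 ≤ p)
    (f : ι → ℂ → ℂ) (hd : ∀ i z, 0 ≤ z.re → z.re ≤ 1 → DifferentiableAt ℂ (f i) z) {C c : ℝ}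
    (hgrowth : ∀ i z, 0 ≤ z.re → z.re ≤ 1 → ‖f i z‖ ≤ C * Real.exp (c * |z.im|))
    {a b θ : ℝ} (ha0 : 0 ≤ a) (hb0 : 0 ≤ b)
    (ha : ∀ z, z.re = 0 → ∑ i, ‖f i z‖ ^ p ≤ (a * Real.exp (θ * |z.im|)) ^ p)
    (hb : ∀ z, z.re = 1 → ∑ i, ‖f i z‖ ^ p ≤ (b * Real.exp (θ * |z.im|)) ^ p)
    {k : ℝ} (hk : 0 < k) {z : ℂ} (hz0 : 0 ≤ z.re) (hz1 : z.re ≤ 1) :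
    ∑ i, ‖f i z‖ ^ p ≤ (Real.exp (k * z.im ^ 2 + k * z.re * (1 - z.re) + (4 * k)⁻¹ * θ ^ 2)
      * (a ^ (1 - z.re) * b ^ z.re)) ^ p := by
  have hp0 : 0 < p := by linarith
  have : Fact (1 ≤ ENNReal.ofReal p) := ⟨by simpa using hp⟩
  have hpt : (ENNReal.ofReal p).toReal = p := ENNReal.toReal_ofReal hp0.le
  -- With values in finite-dimensional `ℓ^p` the sum of `p`-th powers is a power of a norm, so the
  -- Banach-valued three lines theorem applies to the damped function.
  set G : ℂ → PiLp (ENNReal.ofReal p) (fun _ : ι => ℂ) := fun w =>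
    WithLp.toLp _ (fun i => Complex.exp (k * (w ^ 2 - w)) * f i w) with hG
  have hnorm : ∀ w, ‖G w‖ ^ p
      = ‖Complex.exp (k * (w ^ 2 - w))‖ ^ p * ∑ i, ‖f i w‖ ^ p := by
    intro w
    rw [PiLp.norm_eq_sum (by rw [hpt]; exact hp0), hpt,
      ← Real.rpow_mul (Finset.sum_nonneg fun i _ => by positivity), one_div,
      inv_mul_cancel₀ hp0.ne', Real.rpow_one, Finset.mul_sum]
    refine Finset.sum_congr rfl fun i _ => ?_
    rw [hG]
    simp only [norm_mul]
    rw [Real.mul_rpow (norm_nonneg _) (norm_nonneg _)]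
  have hle : ∀ w {t : ℝ}, 0 ≤ t → ∑ i, ‖f i w‖ ^ p ≤ t ^ p →
      ‖G w‖ ≤ ‖Complex.exp (k * (w ^ 2 - w))‖ * t := by
    intro w t ht h
    refine (Real.rpow_le_rpow_iff (norm_nonneg _) (by positivity) hp0).1 ?_
    rw [hnorm, Real.mul_rpow (norm_nonneg _) ht]
    gcongr
  have hdiff : ∀ w : ℂ, 0 ≤ w.re → w.re ≤ 1 → DifferentiableAt ℂ G w := by
    intro w h0 h1
    rw [differentiableAt_piLp]
    intro i
    have := hd i w h0 h1
    simp only [hG]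
    fun_prop
  have hclosed : IsClosed (Complex.HadamardThreeLines.verticalClosedStrip 0 1) :=
    isClosed_Icc.preimage Complex.continuous_re
  have hsub : closure (Complex.HadamardThreeLines.verticalStrip 0 1)
      ⊆ Complex.HadamardThreeLines.verticalClosedStrip 0 1 :=
    closure_minimal (Set.preimage_mono Set.Ioo_subset_Icc_self) hclosed
  have hDC : DiffContOnCl ℂ G (Complex.HadamardThreeLines.verticalStrip 0 1) := by
    refine DifferentiableOn.diffContOnCl fun w hw => ?_
    have hw' := hsub hw
    exact (hdiff w hw'.1 hw'.2).differentiableWithinAt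
  have hbdd : BddAbove ((norm ∘ G) '' Complex.HadamardThreeLines.verticalClosedStrip 0 1) := by
    set D : ℝ := |C| * Real.exp ((4 * k)⁻¹ * c ^ 2) with hD
    have hD0 : 0 ≤ D := by positivity
    refine ⟨(∑ _i : ι, D ^ p) ^ (1 / p), ?_⟩
    rintro _ ⟨w, hw, rfl⟩
    obtain ⟨h0, h1⟩ : 0 ≤ w.re ∧ w.re ≤ 1 := hw
    rw [Function.comp_apply, PiLp.norm_eq_sum (by rw [hpt]; exact hp0), hpt]
    refine Real.rpow_le_rpow (Finset.sum_nonneg fun i _ => by positivity)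
      (Finset.sum_le_sum fun i _ => Real.rpow_le_rpow (norm_nonneg _) ?_ hp0.le) (by positivity)
    rw [hG]
    simp only [norm_mul]
    rw [norm_exp_mul_sq_sub]
    have h2 := hgrowth i w h0 h1
    have h3 : 0 ≤ k * w.re * (1 - w.re) := by
      have : 0 ≤ 1 - w.re := by linarith
      positivity
    have h4 := mul_sub_mul_sq_le hk c w.im
    calc Real.exp (-(k * w.im ^ 2 + k * w.re * (1 - w.re))) * ‖f i w‖
        ≤ Real.exp (-(k * w.im ^ 2)) * (|C| * Real.exp (c * |w.im|)) := by
          gcongr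
          · linarith
          · exact h2.trans (by gcongr; exact le_abs_self C)
      _ = |C| * Real.exp (c * |w.im| - k * w.im ^ 2) := by
          rw [mul_left_comm, ← Real.exp_add]; ring_nf
      _ ≤ D := by rw [hD]; gcongr
  set K := Real.exp ((4 * k)⁻¹ * θ ^ 2) with hK
  have hK0 : 0 < K := Real.exp_pos _
  -- On the edges the Gaussian meets `e^{θ|Im w|}`; completing the square produces the constant `K`.
  have hedge : ∀ (w : ℂ) (t : ℝ), 0 ≤ t → w.re * (1 - w.re) = 0 →
      ∑ i, ‖f i w‖ ^ p ≤ (t * Real.exp (θ * |w.im|)) ^ p → ‖G w‖ ≤ K * t := by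
    intro w t ht hw h
    refine (hle w (by positivity) h).trans ?_
    rw [norm_exp_mul_sq_sub, mul_assoc k, hw, mul_zero, add_zero, mul_left_comm, ← Real.exp_add,
      mul_comm K, hK]
    gcongr
    have := mul_sub_mul_sq_le hk θ w.im
    linarith
  have h1 := Complex.HadamardThreeLines.norm_le_interp_of_mem_verticalClosedStrip₀₁' G (z := z)
    (a := K * a) (b := K * b) ⟨hz0, hz1⟩ hDC hbdd
    (fun w hw => hedge w a ha0 (by rw [show w.re = 0 from hw, zero_mul]) (ha w hw))
    (fun w hw => hedge w b hb0 (by rw [show w.re = 1 from hw, sub_self, mul_zero]) (hb w hw))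
  have h2 : (K * a) ^ (1 - z.re) * (K * b) ^ z.re = K * (a ^ (1 - z.re) * b ^ z.re) := by
    rw [Real.mul_rpow hK0.le ha0, Real.mul_rpow hK0.le hb0]
    have : K ^ (1 - z.re) * K ^ z.re = K := by
      rw [← Real.rpow_add hK0, sub_add_cancel, Real.rpow_one]
    linear_combination (a ^ (1 - z.re) * b ^ z.re) * this
  rw [h2] at h1
  have h3 := Real.rpow_le_rpow (norm_nonneg _) h1 hp0.le
  rw [hnorm, norm_exp_mul_sq_sub, Real.exp_neg, Real.inv_rpow (Real.exp_nonneg _)] at h3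
  rw [inv_mul_le_iff₀ (by positivity), ← Real.mul_rpow (by positivity) (by positivity)] at h3
  refine h3.trans_eq ?_
  rw [hK, ← mul_assoc, ← Real.exp_add]

/-- A family of bounded powers `V z = T^{-z}`, `Re z ≥ 0`, of an operator with inverse `Q`, whose
restriction to `Re z > 0` is the holomorphic family `U`. -/
structure IsPowerFamily {H : Type*} [NormedAddCommGroup H] [InnerProductSpace ℂ H]
    (Q : H →L[ℂ] H) (U V : ℂ → H →L[ℂ] H) (N θ : ℝ) : Prop where
  eq_of_pos : ∀ z : ℂ, 0 < z.re → V z = U z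
  inverse_mul : ∀ z : ℂ, 0 ≤ z.re → Q * V z = U (z + 1)
  mul_inverse : ∀ z : ℂ, 0 ≤ z.re → V z * Q = U (z + 1)
  norm_le : ∀ z : ℂ, z.re = 0 → ‖V z‖ ≤ N * Real.exp (θ * |z.im|)
  differentiableAt : ∀ z : ℂ, 0 < z.re → DifferentiableAt ℂ U z
  growth : ∃ C : ℝ, ∀ z : ℂ, 1 ≤ z.re → z.re ≤ 2 → ‖U z‖ ≤ C * Real.exp (Real.pi * |z.im|)

theorem HasBIP.exists_isPowerFamily {H : Type*} [NormedAddCommGroup H] [InnerProductSpace ℂ H]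
    [CompleteSpace H] {T : H →ₗ.[ℂ] H} {N θ : ℝ} (hBIP : HasBIP T N θ) (hT : IsSectorial T)
    {Q : H →L[ℂ] H} (hQ : IsResolventAt T 0 Q) :
    ∃ V : ℂ → H →L[ℂ] H, (∀ z : ℂ, 0 ≤ z.re → negPow T z = ofBounded (V z)) ∧
      IsPowerFamily Q (dunfordPow T) V N θ := by
  obtain ⟨V, h1, h2, h3, h4, h5⟩ := hBIP.exists_bounded_powers hT hQ
  exact ⟨V, h1, h2, h3, h4, h5, fun z hz => differentiableAt_dunfordPow hT ⟨Q, hQ⟩ hz,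
    exists_norm_dunfordPow_le hT ⟨Q, hQ⟩⟩

/-- The outer operators are moved onto the families, whose synthesis norms grow by `‖W₁‖` and
`‖W₂‖`. The middle operator enters only through its test inequality, so both `A₁` and `A₂*` are
covered. -/
theorem sum_norm_inner_conjugate_le {ι H₁ H₂ : Type*} [Fintype ι] [NormedAddCommGroup H₁]
    [InnerProductSpace ℂ H₁] [NormedAddCommGroup H₂] [InnerProductSpace ℂ H₂] [CompleteSpace H₂]
    {p N₁ N₂ θ₁ θ₂ : ℝ} (hp : 1 ≤ p) {A : H₁ →L[ℂ] H₂} {a : ℝ}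
    (ha : 0 ≤ a) (hA : ∀ (x : ι → H₁) (y : ι → H₂), ∑ i, ‖inner ℂ (y i) (A (x i))‖ ^ p
      ≤ (‖synthesis x‖ * ‖synthesis y‖ * a) ^ p) {W₁ : H₁ →L[ℂ] H₁} {W₂ : H₂ →L[ℂ] H₂}
    {t : ℝ} (hW₁ : ‖W₁‖ ≤ N₁ * Real.exp (θ₁ * |t|)) (hW₂ : ‖W₂‖ ≤ N₂ * Real.exp (θ₂ * |t|))
    (x : ι → H₁) (y : ι → H₂) :
    ∑ i, ‖inner ℂ (y i) (W₂ (A (W₁ (x i))))‖ ^ p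
      ≤ (N₁ * N₂ * (‖synthesis x‖ * ‖synthesis y‖) * a * Real.exp ((θ₁ + θ₂) * |t|)) ^ p := by
  have h := hA (fun i => W₁ (x i)) (fun i => W₂.adjoint (y i))
  simp_rw [ContinuousLinearMap.adjoint_inner_left] at h
  refine h.trans (Real.rpow_le_rpow (by positivity) ?_ (by linarith))
  have h1 := norm_synthesis_comp_le W₁ x
  have h2 := norm_synthesis_comp_le W₂.adjoint y
  rw [LinearIsometryEquiv.norm_map] at h2
  have e : N₁ * N₂ * (‖synthesis x‖ * ‖synthesis y‖) * a * Real.exp ((θ₁ + θ₂) * |t|)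
      = (N₁ * Real.exp (θ₁ * |t|) * ‖synthesis x‖) * (N₂ * Real.exp (θ₂ * |t|) * ‖synthesis y‖)
        * a := by
    rw [add_mul, Real.exp_add]; ring
  rw [e]
  have h3 := h1.trans (mul_le_mul_of_nonneg_right hW₁ (norm_nonneg _))
  have h4 := h2.trans (mul_le_mul_of_nonneg_right hW₂ (norm_nonneg _))
  exact mul_le_mul_of_nonneg_right (mul_le_mul h3 h4 (norm_nonneg _) ((norm_nonneg _).trans h3)) ha

/-! ### The strip estimate and the bounded interpolant -/

section Interpolation

variable {H₁ H₂ : Type*}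
  [NormedAddCommGroup H₁] [InnerProductSpace ℂ H₁] [CompleteSpace H₁]
  [NormedAddCommGroup H₂] [InnerProductSpace ℂ H₂] [CompleteSpace H₂]
  {Q₁ : H₁ →L[ℂ] H₁} {Q₂ : H₂ →L[ℂ] H₂} {U₁ V₁ : ℂ → H₁ →L[ℂ] H₁} {U₂ V₂ : ℂ → H₂ →L[ℂ] H₂}
  {N₁ N₂ θ₁ θ₂ : ℝ} {A₁ : H₁ →L[ℂ] H₂} {A₂ : H₂ →L[ℂ] H₁} {p : ℝ}

/-- The interpolated bound. -/
def interpBound (N₁ N₂ θ₁ θ₂ a₁ a₂ k : ℝ) (z : ℂ) : ℝ :=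
  N₁ * N₂ * Real.exp (k * z.im ^ 2 + k * z.re * (1 - z.re) + (4 * k)⁻¹ * (θ₁ + θ₂) ^ 2)
    * a₁ ^ (1 - z.re) * a₂ ^ z.re

theorem sum_norm_inner_strip_le {ι : Type*} [Fintype ι]
    (h₁ : IsPowerFamily Q₁ U₁ V₁ N₁ θ₁) (h₂ : IsPowerFamily Q₂ U₂ V₂ N₂ θ₂)
    (hN₁ : 0 ≤ N₁) (hN₂ : 0 ≤ N₂) (hA : Q₂ ∘L A₁ = A₂.adjoint ∘L Q₁)
    (hp : 1 ≤ p) (hA₁ : MemSchatten p A₁) (hA₂ : MemSchatten p A₂)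
    {k : ℝ} (hk : 0 < k) {z : ℂ} (hz0 : 0 ≤ z.re) (hz1 : z.re ≤ 1) (h : ι → H₁) (g : ι → H₂) :
    ∑ i, ‖inner ℂ (Q₂.adjoint (g i)) (V₂ z (A₁ (V₁ (1 - z) (Q₁ (h i)))))‖ ^ p
      ≤ (interpBound N₁ N₂ θ₁ θ₂ (schattenNorm p A₁) (schattenNorm p A₂) k z
        * (‖synthesis fun i => Q₁ (Q₁ (h i))‖ * ‖synthesis fun i => Q₂.adjoint (g i)‖)) ^ p := by
  set a₁ := schattenNorm p A₁
  set a₂ := schattenNorm p A₂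
  have ha₁ : 0 ≤ a₁ := schattenNorm_nonneg p A₁
  have ha₂ : 0 ≤ a₂ := schattenNorm_nonneg p A₂
  set X := ‖synthesis fun i => Q₁ (Q₁ (h i))‖
  set Y := ‖synthesis fun i => Q₂.adjoint (g i)‖
  have hX : 0 ≤ X := norm_nonneg _
  have hY : 0 ≤ Y := norm_nonneg _
  have q₁ : ∀ (w : ℂ), 0 ≤ w.re → ∀ v, Q₁ (V₁ w v) = U₁ (w + 1) v := fun w hw v =>
    congrArg (fun B : H₁ →L[ℂ] H₁ => B v) (h₁.inverse_mul w hw)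
  have r₁ : ∀ (w : ℂ), 0 ≤ w.re → ∀ v, V₁ w (Q₁ v) = U₁ (w + 1) v := fun w hw v =>
    congrArg (fun B : H₁ →L[ℂ] H₁ => B v) (h₁.mul_inverse w hw)
  have q₂ : ∀ (w : ℂ), 0 ≤ w.re → ∀ v, Q₂ (V₂ w v) = U₂ (w + 1) v := fun w hw v =>
    congrArg (fun B : H₂ →L[ℂ] H₂ => B v) (h₂.inverse_mul w hw)
  have r₂ : ∀ (w : ℂ), 0 ≤ w.re → ∀ v, V₂ w (Q₂ v) = U₂ (w + 1) v := fun w hw v =>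
    congrArg (fun B : H₂ →L[ℂ] H₂ => B v) (h₂.mul_inverse w hw)
  have hA' : ∀ v, Q₂ (A₁ v) = A₂.adjoint (Q₁ v) := fun v =>
    congrArg (fun B : H₁ →L[ℂ] H₂ => B v) hA
  -- Both exponents have real part at least 1 on the closed strip, so `f i` is differentiable at
  -- every point of it, edges included.
  set f : ι → ℂ → ℂ := fun i w => inner ℂ (g i) (U₂ (w + 1) (A₁ (U₁ (2 - w) (h i)))) with hf
  have hf_eq : ∀ i (w : ℂ), 0 ≤ w.re → w.re ≤ 1 →
      f i w = inner ℂ (Q₂.adjoint (g i)) (V₂ w (A₁ (V₁ (1 - w) (Q₁ (h i))))) := by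
    intro i w hw0 hw1
    rw [ContinuousLinearMap.adjoint_inner_left, q₂ w hw0, r₁ (1 - w) (by simpa using hw1),
      show 1 - w + 1 = 2 - w by ring]
  have hleft : ∀ i (w : ℂ), w.re = 0 →
      f i w = inner ℂ (Q₂.adjoint (g i)) (V₂ w (A₁ (V₁ (-w) (Q₁ (Q₁ (h i)))))) := by
    intro i w hw
    rw [hf_eq i w hw.ge (by rw [hw]; exact zero_le_one), h₁.eq_of_pos (1 - w) (by simp [hw]),
      r₁ (-w) (by simp [hw]), show -w + 1 = 1 - w by ring]
  -- Here `V₂ w = V₂ (w - 1) Q₂` and `Q₁` commutes with `V₁ (1 - w)`; then `Q₂ A₁ = A₂* Q₁`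
  -- exchanges `A₁` for `A₂*`.
  have hright : ∀ i (w : ℂ), w.re = 1 → f i w =
      inner ℂ (Q₂.adjoint (g i)) (V₂ (w - 1) (A₂.adjoint (V₁ (1 - w) (Q₁ (Q₁ (h i)))))) := by
    intro i w hw
    have e1 : ∀ v, Q₁ (V₁ (1 - w) v) = V₁ (1 - w) (Q₁ v) := fun v => by
      rw [q₁ _ (by simp [hw]), r₁ _ (by simp [hw])]
    rw [hf_eq i w (by rw [hw]; exact zero_le_one) hw.le, h₂.eq_of_pos w (by simp [hw]),
      ← e1 (Q₁ (h i)), ← hA', r₂ (w - 1) (by simp [hw]), sub_add_cancel]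
  have hA₁le := fun (x : ι → H₁) (y : ι → H₂) => hA₁.sum_norm_inner_rpow_le hp x y
  -- Swapping the two families transfers the bound to the adjoint, with no need for singular values
  -- of `A₂*`.
  have hA₂le : ∀ (x : ι → H₁) (y : ι → H₂), ∑ i, ‖inner ℂ (y i) (A₂.adjoint (x i))‖ ^ p
      ≤ (‖synthesis x‖ * ‖synthesis y‖ * a₂) ^ p := by
    intro x y
    simp_rw [ContinuousLinearMap.adjoint_inner_right, norm_inner_symm (A₂ _)]
    rw [mul_comm ‖synthesis x‖]
    exact hA₂.sum_norm_inner_rpow_le hp y x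
  obtain ⟨C₁, hC₁⟩ := h₁.growth
  obtain ⟨C₂, hC₂⟩ := h₂.growth
  have hmain := sum_norm_rpow_le_of_three_lines hp f (a := N₁ * N₂ * (X * Y) * a₁)
    (b := N₁ * N₂ * (X * Y) * a₂) (θ := θ₁ + θ₂)
    (C := ∑ i, ‖g i‖ * (C₂ * (‖A₁‖ * (C₁ * ‖h i‖)))) (c := 2 * Real.pi) ?_ ?_ (by positivity)
    (by positivity) ?_ ?_ hk hz0 hz1
  · simp_rw [hf_eq _ z hz0 hz1] at hmain
    refine hmain.trans_eq ?_
    congr 1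
    have hc : 0 ≤ N₁ * N₂ * (X * Y) := by positivity
    rw [Real.mul_rpow hc ha₁, Real.mul_rpow hc ha₂]
    have e : (N₁ * N₂ * (X * Y)) ^ (1 - z.re) * (N₁ * N₂ * (X * Y)) ^ z.re
        = N₁ * N₂ * (X * Y) := by
      rw [← Real.rpow_add' hc (by simp), sub_add_cancel, Real.rpow_one]
    rw [interpBound]
    linear_combination (Real.exp (k * z.im ^ 2 + k * z.re * (1 - z.re)
      + (4 * k)⁻¹ * (θ₁ + θ₂) ^ 2) * a₁ ^ (1 - z.re) * a₂ ^ z.re) * e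
  · intro i w hw0 hw1
    have d2 : DifferentiableAt ℂ (fun w => U₂ (w + 1)) w :=
      DifferentiableAt.comp (g := U₂) (f := fun w => w + 1) w
        (h₂.differentiableAt _ (by simp; linarith)) (by fun_prop)
    have d1 : DifferentiableAt ℂ (fun w => U₁ (2 - w)) w :=
      DifferentiableAt.comp (g := U₁) (f := fun w => 2 - w) w
        (h₁.differentiableAt _ (by simp; linarith)) (by fun_prop)
    have d3 : DifferentiableAt ℂ (fun w => A₁ (U₁ (2 - w) (h i))) w :=
      A₁.differentiableAt.comp w (d1.clm_apply (differentiableAt_const _))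
    exact (innerSL ℂ (g i)).differentiableAt.comp w (d2.clm_apply d3)
  · intro i w hw0 hw1
    have b2 := hC₂ (w + 1) (by simp; linarith) (by simp; linarith)
    have b1 := hC₁ (2 - w) (by simp; linarith) (by simp; linarith)
    have i1 : (2 - w).im = -w.im := by simp
    have i2 : (w + 1).im = w.im := by simp
    rw [i1, abs_neg] at b1
    rw [i2] at b2
    set e := Real.exp (Real.pi * |w.im|) with he
    have hC₁0 : 0 ≤ C₁ := nonneg_of_mul_nonneg_left ((norm_nonneg _).trans b1) (Real.exp_pos _)
    have hC₂0 : 0 ≤ C₂ := nonneg_of_mul_nonneg_left ((norm_nonneg _).trans b2) (Real.exp_pos _)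
    have hee : Real.exp (2 * Real.pi * |w.im|) = e * e := by
      rw [he, ← Real.exp_add]; ring_nf
    calc ‖f i w‖ ≤ ‖g i‖ * ‖U₂ (w + 1) (A₁ (U₁ (2 - w) (h i)))‖ := norm_inner_le_norm _ _
      _ ≤ ‖g i‖ * ((C₂ * e) * (‖A₁‖ * ((C₁ * e) * ‖h i‖))) := by
          gcongr
          refine ((U₂ (w + 1)).le_of_opNorm_le b2 _).trans ?_
          gcongr
          refine (A₁.le_opNorm _).trans ?_
          gcongr
          exact (U₁ (2 - w)).le_of_opNorm_le b1 _
      _ = (‖g i‖ * (C₂ * (‖A₁‖ * (C₁ * ‖h i‖)))) * (e * e) := by ring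
      _ ≤ _ := by
          rw [hee]
          gcongr
          exact Finset.single_le_sum (f := fun i => ‖g i‖ * (C₂ * (‖A₁‖ * (C₁ * ‖h i‖))))
            (fun i _ => by positivity) (Finset.mem_univ i)
  · intro w hw
    simp_rw [fun i => hleft i w hw]
    refine sum_norm_inner_conjugate_le hp ha₁ hA₁le ?_ (h₂.norm_le w hw) _ _
    simpa using h₁.norm_le (-w) (by simp [hw])
  · intro w hw
    simp_rw [fun i => hright i w hw]
    refine sum_norm_inner_conjugate_le hp ha₂ hA₂le ?_ ?_ _ _
    · simpa using h₁.norm_le (1 - w) (by simp [hw])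
    · simpa using h₂.norm_le (w - 1) (by simp [hw])

theorem norm_synthesis_unit_le {E : Type*} [NormedAddCommGroup E] [InnerProductSpace ℂ E] (x : E) :
    ‖synthesis fun _ : Unit => x‖ ≤ ‖x‖ := by
  refine ContinuousLinearMap.opNorm_le_bound _ (norm_nonneg _) fun c => ?_
  rw [synthesis_apply]
  simp [norm_smul, EuclideanSpace.norm_eq, mul_comm]

theorem interpBound_nonneg (hN₁ : 0 ≤ N₁) (hN₂ : 0 ≤ N₂) {a₁ a₂ : ℝ} (ha₁ : 0 ≤ a₁) (ha₂ : 0 ≤ a₂)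
    (k : ℝ) (z : ℂ) : 0 ≤ interpBound N₁ N₂ θ₁ θ₂ a₁ a₂ k z := by
  unfold interpBound
  positivity

/-- One-element families give `‖C u‖ ≤ M 1 * ‖Q₁ u‖`, so `Q₁ u ↦ C u` extends to a bounded operator.
The estimate for longer families then passes by density to all families, in particular orthonormal
ones, for every `k`. -/
theorem exists_bounded_interpolant
    (h₁ : IsPowerFamily Q₁ U₁ V₁ N₁ θ₁) (h₂ : IsPowerFamily Q₂ U₂ V₂ N₂ θ₂)
    (hQ₁ : DenseRange Q₁) (hQ₂ : DenseRange Q₂.adjoint)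
    (hN₁ : 0 ≤ N₁) (hN₂ : 0 ≤ N₂) (hA : Q₂ ∘L A₁ = A₂.adjoint ∘L Q₁)
    (hp : 1 ≤ p) (hA₁ : MemSchatten p A₁) (hA₂ : MemSchatten p A₂)
    {z : ℂ} (hz0 : 0 ≤ z.re) (hz1 : z.re ≤ 1) :
    ∃ B : H₁ →L[ℂ] H₂, (∀ u, B (Q₁ u) = V₂ z (A₁ (V₁ (1 - z) u))) ∧ MemSchatten p B ∧
      ∀ k : ℝ, 0 < k → schattenNorm p B ≤
        interpBound N₁ N₂ θ₁ θ₂ (schattenNorm p A₁) (schattenNorm p A₂) k z := by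
  have hp0 : 0 < p := by linarith
  set M : ℝ → ℝ := fun k =>
    interpBound N₁ N₂ θ₁ θ₂ (schattenNorm p A₁) (schattenNorm p A₂) k z with hM
  have hM0 : ∀ k, 0 ≤ M k := fun k =>
    interpBound_nonneg hN₁ hN₂ (schattenNorm_nonneg p A₁) (schattenNorm_nonneg p A₂) k z
  have hQQ : DenseRange fun h => Q₁ (Q₁ h) := hQ₁.comp hQ₁ Q₁.continuous
  set C : H₁ →L[ℂ] H₂ := V₂ z ∘L A₁ ∘L V₁ (1 - z) with hC
  have hCQ : ∀ h g, ‖inner ℂ (Q₂.adjoint g) (C (Q₁ h))‖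
      ≤ M 1 * ‖Q₁ (Q₁ h)‖ * ‖Q₂.adjoint g‖ := by
    intro h g
    have h3 := sum_norm_inner_strip_le (ι := Unit) h₁ h₂ hN₁ hN₂ hA hp hA₁ hA₂ one_pos hz0 hz1
      (fun _ => h) (fun _ => g)
    rw [Finset.univ_unique, Finset.sum_singleton,
      Real.rpow_le_rpow_iff (norm_nonneg _) (mul_nonneg (hM0 1) (by positivity)) hp0] at h3
    refine h3.trans ?_
    rw [mul_assoc]
    refine mul_le_mul_of_nonneg_left ?_ (hM0 1)
    gcongr <;> exact norm_synthesis_unit_le _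
  have hCQ' : ∀ h g, ‖inner ℂ g (C (Q₁ h))‖ ≤ M 1 * ‖Q₁ (Q₁ h)‖ * ‖g‖ := fun h g =>
    hQ₂.induction_on (p := fun g => ‖inner ℂ g (C (Q₁ h))‖ ≤ M 1 * ‖Q₁ (Q₁ h)‖ * ‖g‖) g
      (isClosed_le (by fun_prop) (by fun_prop)) (hCQ h)
  have hCn : ∀ u, ‖C u‖ ≤ M 1 * ‖Q₁ u‖ := fun u =>
    hQ₁.induction_on (p := fun u => ‖C u‖ ≤ M 1 * ‖Q₁ u‖) u
      (isClosed_le (by fun_prop) (by fun_prop)) fun h => by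
        have h4 := hCQ' h (C (Q₁ h))
        rw [inner_self_eq_norm_sq_to_K] at h4
        have h5 : ‖C (Q₁ h)‖ * ‖C (Q₁ h)‖ ≤ M 1 * ‖Q₁ (Q₁ h)‖ * ‖C (Q₁ h)‖ := by
          simpa [pow_two] using h4
        rcases (norm_nonneg (C (Q₁ h))).eq_or_lt with h6 | h6
        · rw [← h6]
          exact mul_nonneg (hM0 1) (norm_nonneg _)
        · exact le_of_mul_le_mul_right h5 h6
  set B : H₁ →L[ℂ] H₂ := (C : H₁ →ₗ[ℂ] H₂).extendOfNorm (Q₁ : H₁ →ₗ[ℂ] H₁) with hB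
  have hBQ : ∀ u, B (Q₁ u) = V₂ z (A₁ (V₁ (1 - z) u)) := fun u =>
    LinearMap.extendOfNorm_eq (f := (C : H₁ →ₗ[ℂ] H₂)) (e := (Q₁ : H₁ →ₗ[ℂ] H₁)) hQ₁
      ⟨M 1, hCn⟩ u
  have hpair : ∀ k, 0 < k → ∀ (n : ℕ) (x : Fin n → H₁) (y : Fin n → H₂),
      ∑ i, ‖inner ℂ (y i) (B (x i))‖ ^ p ≤ (M k * (‖synthesis x‖ * ‖synthesis y‖)) ^ p := by
    intro k hk n
    have cont₁ := continuous_synthesis (ι := Fin n) (E := H₁)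
    have cont₂ := continuous_synthesis (ι := Fin n) (E := H₂)
    have hd₁ : DenseRange (fun (h : Fin n → H₁) i => Q₁ (Q₁ (h i))) :=
      DenseRange.piMap fun _ => hQQ
    have hd₂ : DenseRange (fun (g : Fin n → H₂) i => Q₂.adjoint (g i)) :=
      DenseRange.piMap fun _ => hQ₂
    intro x y
    refine hd₁.induction_on (p := fun x => ∑ i, ‖inner ℂ (y i) (B (x i))‖ ^ p
      ≤ (M k * (‖synthesis x‖ * ‖synthesis y‖)) ^ p) x ?_ fun h => ?_
    · refine isClosed_le (continuous_finsetSum _ fun i _ => ?_) ?_ <;>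
      exact Continuous.rpow_const (by fun_prop) fun _ => Or.inr hp0.le
    refine hd₂.induction_on (p := fun y => ∑ i, ‖inner ℂ (y i) (B (Q₁ (Q₁ (h i))))‖ ^ p
      ≤ (M k * (‖synthesis fun i => Q₁ (Q₁ (h i))‖ * ‖synthesis y‖)) ^ p) y ?_ fun g => ?_
    · refine isClosed_le (continuous_finsetSum _ fun i _ => ?_) ?_ <;>
      exact Continuous.rpow_const (by fun_prop) fun _ => Or.inr hp0.le
    simp_rw [hBQ]
    exact sum_norm_inner_strip_le h₁ h₂ hN₁ hN₂ hA hp hA₁ hA₂ hk hz0 hz1 h g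
  have hmem : ∀ k, 0 < k → MemSchatten p B ∧ schattenNorm p B ≤ M k := fun k hk =>
    memSchatten_of_sum_norm_inner_rpow_le hp (hM0 k) B fun n x y hx hy => by
      refine (hpair k hk n x y).trans (Real.rpow_le_rpow
        (mul_nonneg (hM0 k) (by positivity)) ?_ hp0.le)
      exact mul_le_of_le_one_right (hM0 k) (mul_le_one₀ (norm_synthesis_le_one hx) (norm_nonneg _)
        (norm_synthesis_le_one hy))
  exact ⟨B, hBQ, (hmem 1 one_pos).1, fun k hk => (hmem k hk).2⟩

end Interpolation

/-! ### Products, inverses and closures of unbounded operators -/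

section Unbounded

variable {E F G : Type*}
  [NormedAddCommGroup E] [InnerProductSpace ℂ E]
  [NormedAddCommGroup F] [InnerProductSpace ℂ F]
  [NormedAddCommGroup G] [InnerProductSpace ℂ G]

theorem mem_opProd_domain_iff {A : F →ₗ.[ℂ] G} {B : E →ₗ.[ℂ] F} {x : E} :
    x ∈ (opProd A B).domain ↔ ∃ h : x ∈ B.domain, B ⟨x, h⟩ ∈ A.domain := by
  constructor
  · rintro ⟨y, hy, rfl⟩
    exact ⟨y.2, hy⟩
  · rintro ⟨h, h'⟩
    exact ⟨⟨x, h⟩, h', rfl⟩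

theorem opProd_apply {A : F →ₗ.[ℂ] G} {B : E →ₗ.[ℂ] F} {x : E} (hx : x ∈ (opProd A B).domain)
    (h : x ∈ B.domain) (h' : B ⟨x, h⟩ ∈ A.domain) :
    opProd A B ⟨x, hx⟩ = A ⟨B ⟨x, h⟩, h'⟩ := rfl

/-- The graph of `B` is closed, and the graph of `A` is dense in it because `x ↦ (x, B x)` is
continuous. -/
theorem isClosable_and_closure_eq_ofBounded {A : E →ₗ.[ℂ] F} {B : E →L[ℂ] F}
    (hd : Dense (A.domain : Set E)) (h : ∀ x (hx : x ∈ A.domain), A ⟨x, hx⟩ = B x) :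
    A.IsClosable ∧ A.closure = ofBounded B := by
  have hgraph : A.graph.topologicalClosure = (ofBounded B).graph := by
    have hmem : ∀ q : E × F, q ∈ (ofBounded B).graph ↔ q.2 = B q.1 := by
      intro q
      rw [LinearPMap.mem_graph_iff]
      constructor
      · rintro ⟨y, hy, hy'⟩
        rw [← hy', ← hy]
        rfl
      · intro hq
        exact ⟨⟨q.1, trivial⟩, rfl, hq.symm⟩
    apply le_antisymm
    · refine Submodule.topologicalClosure_minimal _ ?_ ?_
      · rintro ⟨x, y⟩ hxy
        obtain ⟨w, rfl, rfl⟩ := (LinearPMap.mem_graph_iff A).1 hxy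
        rw [hmem]
        exact h w w.2
      · have : ((ofBounded B).graph : Set (E × F)) = {q | q.2 = B q.1} := by
          ext q; exact hmem q
        rw [this]
        exact isClosed_eq (by fun_prop) (by fun_prop)
    · rintro ⟨x, y⟩ hxy
      have hy : y = B x := (hmem _).1 hxy
      rw [hy]
      have hcont : Continuous fun x : E => (x, B x) := by fun_prop
      refine map_mem_closure (f := fun x : E => (x, B x)) hcont (hd x) fun w hw => ?_
      exact (LinearPMap.mem_graph_iff A).2 ⟨⟨w, hw⟩, rfl, h w hw⟩
  have hcl : A.IsClosable := ⟨_, hgraph⟩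
  exact ⟨hcl, LinearPMap.eq_of_eq_graph (hcl.graph_closure_eq_closure_graph.symm.trans hgraph)⟩

variable {T : E →ₗ.[ℂ] E} {Q : E →L[ℂ] E}

theorem IsResolventAt.inverse_mem (hQ : IsResolventAt T 0 Q) (y : E) : Q y ∈ T.domain :=
  (hQ.2 y).1

theorem IsResolventAt.apply_inverse (hQ : IsResolventAt T 0 Q) (y : E) :
    T ⟨Q y, hQ.inverse_mem y⟩ = y := by
  obtain ⟨h, e⟩ := hQ.2 y
  simpa using e

theorem IsResolventAt.inverse_apply (hQ : IsResolventAt T 0 Q) (x : T.domain) : Q (T x) = x := by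
  simpa using hQ.1 x

theorem IsResolventAt.denseRange_inverse (hQ : IsResolventAt T 0 Q)
    (hd : Dense (T.domain : Set E)) : DenseRange Q :=
  hd.mono fun x hx => ⟨T ⟨x, hx⟩, hQ.inverse_apply ⟨x, hx⟩⟩

theorem IsResolventAt.ker_eq_bot (hQ : IsResolventAt T 0 Q) : LinearMap.ker T.toFun = ⊥ := by
  rw [LinearMap.ker_eq_bot']
  intro x hx
  have h := hQ.inverse_apply x
  have hx' : T x = 0 := hx
  rw [hx', map_zero] at h
  exact Subtype.ext h.symm

theorem IsResolventAt.denseRange_adjoint [CompleteSpace E] (hQ : IsResolventAt T 0 Q) :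
    DenseRange Q.adjoint := by
  have h1 : Q.adjoint.rangeᗮ = ⊥ := by
    rw [ContinuousLinearMap.orthogonal_range, ContinuousLinearMap.adjoint_adjoint,
      LinearMap.ker_eq_bot']
    intro y hy
    have hy' : Q y = 0 := hy
    have h2 := hQ.apply_inverse y
    have h3 : (⟨Q y, hQ.inverse_mem y⟩ : T.domain) = 0 := Subtype.ext hy'
    rw [h3, LinearPMap.map_zero] at h2
    exact h2.symm
  rw [← Submodule.topologicalClosure_eq_top_iff,
    ← Submodule.dense_iff_topologicalClosure_eq_top] at h1
  exact h1

/-- If `S T⁻¹ = A` then `A y` is `S x` for the solution `x` of `T x = y`. -/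
theorem exists_of_opProd_inverse_eq {T : E →ₗ.[ℂ] F} (hker : LinearMap.ker T.toFun = ⊥)
    {S : E →ₗ.[ℂ] G} {A : F →L[ℂ] G} (hA : opProd S T.inverse = ofBounded A) (y : F) :
    ∃ (x : E) (hx : x ∈ T.domain) (hx' : x ∈ S.domain), T ⟨x, hx⟩ = y ∧ S ⟨x, hx'⟩ = A y := by
  have hy : y ∈ (opProd S T.inverse).domain := by rw [hA]; trivial
  obtain ⟨h, h'⟩ := mem_opProd_domain_iff.1 hy
  have h2 := h
  rw [LinearPMap.inverse_domain] at h2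
  obtain ⟨x, hx⟩ := h2
  have h3 : T.inverse ⟨y, h⟩ = x := LinearPMap.inverse_apply_eq hker hx
  have h4 := apply_of_eq_ofBounded hA y hy
  rw [opProd_apply hy h h'] at h4
  simp only [h3] at h4 h'
  exact ⟨x, x.2, h', hx, h4⟩

/-- Evaluating `LinearPMap.inverse` through `LinearPMap.inverse_apply_eq` requires a trivial kernel;
for the adjoint this comes from surjectivity of `T`. -/
theorem adjoint_ker_eq_bot [CompleteSpace E] {T : E →ₗ.[ℂ] E} (hd : Dense (T.domain : Set E))
    (hT : Function.Surjective T) : LinearMap.ker T†.toFun = ⊥ := by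
  rw [LinearMap.ker_eq_bot']
  intro k hk
  have hk' : T† k = 0 := hk
  obtain ⟨x, hx⟩ := hT k
  have h := LinearPMap.adjoint_isFormalAdjoint hd k x
  rw [hk', hx, inner_zero_left] at h
  exact Subtype.ext (inner_self_eq_zero.1 h.symm)

end Unbounded

/-! ### Compatibility of the two endpoint operators, and the sandwiched product -/

section Sandwich

variable {H₁ H₂ : Type*}
  [NormedAddCommGroup H₁] [InnerProductSpace ℂ H₁]
  [NormedAddCommGroup H₂] [InnerProductSpace ℂ H₂]
  {T₁ : H₁ →ₗ.[ℂ] H₁} {T₂ : H₂ →ₗ.[ℂ] H₂} {S : H₁ →ₗ.[ℂ] H₂}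
  {Q₁ : H₁ →L[ℂ] H₁} {Q₂ : H₂ →L[ℂ] H₂} {A₁ : H₁ →L[ℂ] H₂} {A₂ : H₂ →L[ℂ] H₁}

/-- Both sides are `T₂⁻¹ S T₁⁻¹`: pairing with `g = T₂* k`, where `k` also lies in `dom S*`, one
moves first `T₂` and then `S` across the inner product. -/
theorem inverse_comp_eq_adjoint_comp_inverse [CompleteSpace H₁] [CompleteSpace H₂]
    (hQ₁ : IsResolventAt T₁ 0 Q₁) (hQ₂ : IsResolventAt T₂ 0 Q₂)
    (hd₂ : Dense (T₂.domain : Set H₂)) (hdS : Dense (S.domain : Set H₁))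
    (hA₁ : opProd S T₁.inverse = ofBounded A₁) (hA₂ : opProd S† T₂†.inverse = ofBounded A₂) :
    Q₂ ∘L A₁ = A₂.adjoint ∘L Q₁ := by
  ext w
  refine ext_inner_left ℂ fun g => ?_
  have hker : LinearMap.ker T₂†.toFun = ⊥ :=
    adjoint_ker_eq_bot hd₂ fun y => ⟨_, hQ₂.apply_inverse y⟩
  obtain ⟨k, hk, hk', hkg, hkA⟩ := exists_of_opProd_inverse_eq hker hA₂ g
  obtain ⟨x, hx, hx', hxw, hxA⟩ := exists_of_opProd_inverse_eq hQ₁.ker_eq_bot hA₁ w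
  have hQx : Q₁ w = x := by rw [← hxw]; exact hQ₁.inverse_apply ⟨x, hx⟩
  rw [ContinuousLinearMap.comp_apply, ContinuousLinearMap.comp_apply,
    ContinuousLinearMap.adjoint_inner_right, ← hkg, ← hxA, hQx]
  have e1 := LinearPMap.adjoint_isFormalAdjoint hd₂ ⟨k, hk⟩
    ⟨Q₂ (S ⟨x, hx'⟩), hQ₂.inverse_mem _⟩
  rw [hQ₂.apply_inverse] at e1
  have e2 := LinearPMap.adjoint_isFormalAdjoint hdS ⟨k, hk'⟩ ⟨x, hx'⟩
  rw [e1, ← e2, hkA, hkg]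

/-- Since `V₁` commutes with `T₁⁻¹`, it maps `dom T₁` into itself and `S V₁ x = A₁ V₁ T₁ x` there.
-/
theorem sandwich_apply_of_mem {z : ℂ} {V₁ : H₁ →L[ℂ] H₁} {V₂ : H₂ →L[ℂ] H₂} {B : H₁ →L[ℂ] H₂}
    (hQ₁ : IsResolventAt T₁ 0 Q₁) (hA₁ : opProd S T₁.inverse = ofBounded A₁)
    (hV₁ : negPow T₁ (1 - z) = ofBounded V₁) (hV₂ : negPow T₂ z = ofBounded V₂)
    (hcomm : V₁ * Q₁ = Q₁ * V₁) (hB : ∀ u, B (Q₁ u) = V₂ (A₁ (V₁ u))) {x : H₁}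
    (hx : x ∈ T₁.domain) :
    ∃ h : x ∈ (sandwich T₁ T₂ S z).domain, sandwich T₁ T₂ S z ⟨x, h⟩ = B x := by
  have hQx : Q₁ (T₁ ⟨x, hx⟩) = x := hQ₁.inverse_apply ⟨x, hx⟩
  set u := T₁ ⟨x, hx⟩
  obtain ⟨w, hw, hw', hwu, hwA⟩ := exists_of_opProd_inverse_eq hQ₁.ker_eq_bot hA₁ (V₁ u)
  have hVx : V₁ x = w := by
    have h1 := hQ₁.inverse_apply ⟨w, hw⟩
    rw [hwu] at h1
    rw [← hQx, ← mul_apply_eq_comp, hcomm, mul_apply_eq_comp, h1]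
  rw [sandwich, hV₁, hV₂]
  have m1 : ofBounded V₁ ⟨x, trivial⟩ ∈ S.domain := by
    change V₁ x ∈ S.domain
    rwa [hVx]
  have m2 : x ∈ (opProd S (ofBounded V₁)).domain := mem_opProd_domain_iff.2 ⟨trivial, m1⟩
  have m3 : x ∈ (opProd (ofBounded V₂) (opProd S (ofBounded V₁))).domain :=
    mem_opProd_domain_iff.2 ⟨m2, trivial⟩
  refine ⟨m3, ?_⟩
  rw [opProd_apply m3 m2 trivial]
  change V₂ (S ⟨V₁ x, m1⟩) = B x
  simp only [hVx, hwA]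
  rw [← hB, hQx]

end Sandwich

theorem le_mul_exp_sqrt_of_forall_le {a c d θ q : ℝ} (hc : 0 ≤ c) (hd : 0 ≤ d) (hθ : 0 ≤ θ)
    (hq : 0 ≤ q) (h : ∀ k : ℝ, 0 < k → a ≤ c * Real.exp (k * q + (4 * k)⁻¹ * θ ^ 2) * d) :
    a ≤ c * Real.exp (θ * Real.sqrt q) * d := by
  have hlim : Tendsto (fun η : ℝ => c * Real.exp ((θ + η) * Real.sqrt (q + η)) * d) (𝓝[>] 0)
      (𝓝 (c * Real.exp ((θ + 0) * Real.sqrt (q + 0)) * d)) :=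
    (Continuous.tendsto (by fun_prop) 0).mono_left nhdsWithin_le_nhds
  rw [add_zero, add_zero] at hlim
  refine ge_of_tendsto hlim ?_
  filter_upwards [self_mem_nhdsWithin] with η hη
  have hη : 0 < η := hη
  set r := Real.sqrt (q + η) with hr
  have hr0 : 0 < r := Real.sqrt_pos.2 (by linarith)
  have hr2 : r ^ 2 = q + η := Real.sq_sqrt (by linarith)
  -- The minimizer `θ / (2 √q)` degenerates when `θ` or `q` is 0, so both are raised by `η`, which
  -- is then sent to 0.
  have hk : 0 < (θ + η) / (2 * r) := by positivity
  refine (h _ hk).trans ?_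
  gcongr
  have e : (θ + η) * r = (θ + η) / (2 * r) * r ^ 2 + (4 * ((θ + η) / (2 * r)))⁻¹ * (θ + η) ^ 2 := by
    field_simp
    ring
  rw [e]
  gcongr
  · linarith
  · linarith

end SectorialInterpolation

end

open SectorialInterpolation
theorem corollary4p8
    {H₁ H₂ : Type*}
    [NormedAddCommGroup H₁] [InnerProductSpace ℂ H₁] [CompleteSpace H₁]
    [TopologicalSpace.SeparableSpace H₁]
    [NormedAddCommGroup H₂] [InnerProductSpace ℂ H₂] [CompleteSpace H₂]
    [TopologicalSpace.SeparableSpace H₂]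
    (T₁ : H₁ →ₗ.[ℂ] H₁) (T₂ : H₂ →ₗ.[ℂ] H₂) (S : H₁ →ₗ.[ℂ] H₂)
    -- `T_j` is sectorial and `T_j⁻¹ ∈ B(H_j)`
    (hT₁ : IsSectorial T₁) (hT₂ : IsSectorial T₂)
    (hT₁inv : (0 : ℂ) ∈ resSet T₁)
    (hT₂inv : (0 : ℂ) ∈ resSet T₂)
    (hS : S.IsClosed)
    (hdom : T₁.domain ≤ S.domain) (hdom' : T₂†.domain ≤ S†.domain)
    (N₁ N₂ θ₁ θ₂ : ℝ) (hBIP₁ : HasBIP T₁ N₁ θ₁) (hBIP₂ : HasBIP T₂ N₂ θ₂)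
    (p : ℝ) (hp : 1 ≤ p)
    -- `A₁ = S T₁⁻¹ ∈ B_p(H₁, H₂)` and `A₂ = S* (T₂*)⁻¹ ∈ B_p(H₂, H₁)`
    (A₁ : H₁ →L[ℂ] H₂) (hA₁ : opProd S T₁.inverse = ofBounded A₁)
    (hA₁p : MemSchatten p A₁)
    (A₂ : H₂ →L[ℂ] H₁) (hA₂ : opProd S† T₂†.inverse = ofBounded A₂)
    (hA₂p : MemSchatten p A₂) :
    -- `B z` is the closure of `T₂^{-z} S T₁^{-1+z}` defined on `dom T₁`
    ∃ B : ℂ → (H₁ →L[ℂ] H₂),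
      (∀ z : ℂ, 0 ≤ z.re → z.re ≤ 1 →
        T₁.domain ≤ (sandwich T₁ T₂ S z).domain ∧
        ((sandwich T₁ T₂ S z).domRestrict T₁.domain).IsClosable ∧
        ((sandwich T₁ T₂ S z).domRestrict T₁.domain).closure = ofBounded (B z) ∧
        MemSchatten p (B z) ∧
        ∀ k : ℝ, 0 < k →
          schattenNorm p (B z) ≤
            N₁ * N₂ * Real.exp (k * z.im ^ 2 + k * z.re * (1 - z.re)
                + (4 * k)⁻¹ * (θ₁ + θ₂) ^ 2)
              * schattenNorm p A₁ ^ (1 - z.re) * schattenNorm p A₂ ^ z.re) ∧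
      (∀ x : ℝ, 0 ≤ x → x ≤ 1 →
        schattenNorm p (B (x : ℂ)) ≤
          N₁ * N₂ * Real.exp ((θ₁ + θ₂) * Real.sqrt (x * (1 - x)))
            * schattenNorm p A₁ ^ (1 - x) * schattenNorm p A₂ ^ x) := by

  obtain ⟨Q₁, hQ₁⟩ := hT₁inv
  obtain ⟨Q₂, hQ₂⟩ := hT₂inv
  have hd₁ : Dense (T₁.domain : Set H₁) := hT₁.choose_spec.dense_domain
  have hd₂ : Dense (T₂.domain : Set H₂) := hT₂.choose_spec.dense_domain
  have hN₁ : 0 ≤ N₁ := zero_le_one.trans hBIP₁.one_le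
  have hN₂ : 0 ≤ N₂ := zero_le_one.trans hBIP₂.one_le
  obtain ⟨V₁, hV₁, hpow₁⟩ := hBIP₁.exists_isPowerFamily hT₁ hQ₁
  obtain ⟨V₂, hV₂, hpow₂⟩ := hBIP₂.exists_isPowerFamily hT₂ hQ₂
  have hA := inverse_comp_eq_adjoint_comp_inverse hQ₁ hQ₂ hd₂ (hd₁.mono hdom) hA₁ hA₂
  have hex : ∀ z : ℂ, ∃ B : H₁ →L[ℂ] H₂, 0 ≤ z.re → z.re ≤ 1 →
      (∀ u, B (Q₁ u) = V₂ z (A₁ (V₁ (1 - z) u))) ∧ MemSchatten p B ∧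
      ∀ k : ℝ, 0 < k → schattenNorm p B ≤
        interpBound N₁ N₂ θ₁ θ₂ (schattenNorm p A₁) (schattenNorm p A₂) k z := by
    intro z
    by_cases hz : 0 ≤ z.re ∧ z.re ≤ 1
    · obtain ⟨B, hB⟩ := exists_bounded_interpolant hpow₁ hpow₂ (hQ₁.denseRange_inverse hd₁)
        hQ₂.denseRange_adjoint hN₁ hN₂ hA hp hA₁p hA₂p hz.1 hz.2
      exact ⟨B, fun _ _ => hB⟩
    · exact ⟨0, fun h0 h1 => absurd ⟨h0, h1⟩ hz⟩
  choose B hB using hex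
  refine ⟨B, fun z hz0 hz1 => ?_, fun x hx0 hx1 => ?_⟩
  · obtain ⟨hBQ, hmem, hbound⟩ := hB z hz0 hz1
    have hz1' : 0 ≤ (1 - z).re := by simpa using hz1
    have hval := fun {x : H₁} (hx : x ∈ T₁.domain) =>
      sandwich_apply_of_mem (T₂ := T₂) (S := S) (z := z) hQ₁ hA₁ (hV₁ (1 - z) hz1') (hV₂ z hz0)
        ((hpow₁.mul_inverse _ hz1').trans (hpow₁.inverse_mul _ hz1').symm) hBQ hx
    have hle : T₁.domain ≤ (sandwich T₁ T₂ S z).domain := fun x hx => (hval hx).choose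
    -- `domRestrict` intersects the domains; `hle` shows that nothing of `dom T₁` is lost, which
    -- gives the density needed for the closure.
    have hdomR : ((sandwich T₁ T₂ S z).domRestrict T₁.domain).domain = T₁.domain := by
      rw [LinearPMap.domRestrict_domain, inf_eq_left]
      exact hle
    have hcl := isClosable_and_closure_eq_ofBounded (B := B z)
      (A := (sandwich T₁ T₂ S z).domRestrict T₁.domain) (by rwa [hdomR]) (fun x hx => by
        obtain ⟨h, e⟩ := hval hx.1
        rw [← e]
        exact LinearPMap.domRestrict_apply rfl)
    exact ⟨hle, hcl.1, hcl.2, hmem, hbound⟩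
  · obtain ⟨-, -, hbound⟩ := hB (x : ℂ) (by simpa using hx0) (by simpa using hx1)
    have ha₁ := schattenNorm_nonneg p A₁
    have ha₂ := schattenNorm_nonneg p A₂
    have h := le_mul_exp_sqrt_of_forall_le (a := schattenNorm p (B x)) (c := N₁ * N₂)
      (d := schattenNorm p A₁ ^ (1 - x) * schattenNorm p A₂ ^ x) (θ := θ₁ + θ₂)
      (q := x * (1 - x)) (by positivity) (by positivity)
      (add_nonneg hBIP₁.nonneg hBIP₂.nonneg) (mul_nonneg hx0 (by linarith)) fun k hk => by
        refine (hbound k hk).trans_eq ?_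
        simp only [interpBound, Complex.ofReal_re, Complex.ofReal_im]
        ring_nf
    rwa [← mul_assoc] at h
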